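/- **Definitions.** Let $k$ be a nonnegative integer. A $k$-hypergraph on a finite set $V$ is a set $\mathcal H$ of $k$-element subsets of $V$. For $U\subseteq V$, a vertex $v\in U$ is *dominating in $U$* if every $k$-set $E$ with $v\in E\subseteq U$ lies in $\mathcal H$, and *isolating in $U$* if no such $E$ lies in $\mathcal H$. An *elimination order* is an enumeration $v_1,\dots,v_n$ of $V$ in which each $v_i$ is dominating or isolating in $\{v_1,\dots,v_i\}$; $\mathcal H$ is *orderable* if it has one. A *perfect matching* is a set of pairwise disjoint edges whose union is $V$. As input to a Turing machine, a $k$-hypergraph on $\{1,\dots,n\}$ is given by the string $1^n0w$, where $w$ lists, for all $n^k$ tuples $(x_1,\dots,x_k)$ in lexicographic order, the bit telling whether $\{x_1,\dots,x_k\}\in\mathcal H$; so, for fixed $k$, polynomial in the input length is the same as polynomial in $n$. **Theorem 1.** For every fixed $k$ the following hold. 1. It can be decided in polynomial time whether a given $k$-hypergraph is orderable. 2. It can be decided in polynomial time whether a given orderable $k$-hypergraph has a perfect matching. 3. Orderability is decided by recursively removing a vertex that is dominating or isolating in $V$. That is, let $\mathcal H$ be a $k$-hypergraph on a finite set $V$,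 and for $v\in V$ let $\mathcal H-v:=\{E\in\mathcal H: v\notin E\}$, a $k$-hypergraph on $V\setminus\{v\}$. If $|V|\le k$, then $\mathcal H$ is orderable. If $|V|>k$, then $\mathcal H$ is orderable if and only if some vertex $v$ is dominating or isolating in $V$ and $\mathcal H-v$ is orderable. For every vertex $v$ that is dominating or isolating in $V$, $\mathcal H$ is orderable if and only if $\mathcal H-v$ is (so any such $v$ may be removed). 4. Let $v_1,\dots,v_n$ be an elimination order of a $k$-hypergraph $\mathcal H$. Designate $v_i$ as dominating if it is dominating in $\{v_1,\dots,v_i\}$, and as isolating otherwise. Let $d_j$ and $i_j$ be the numbers of vertices $v_i$ with $i\ge j$ that are designated dominating and isolating, respectively, and let $r_j=(k-1)d_j-i_j$. Then $\mathcal H$ has a perfect matching if and only if $k$ divides $n$ and $r_j\ge 0$ for all $j=1,\dots,n$. -/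

import Mathlib

/-- A `k`-hypergraph on `V`: a set of `k`-element subsets of `V`. -/
@[ext]
structure KHypergraph (k : ℕ) (V : Type*) where
  /-- the set of edges -/
  edges : Set (Finset V)
  /-- every edge has exactly `k` elements -/
  card_eq : ∀ E ∈ edges, E.card = k

namespace KHypergraph

variable {k : ℕ} {V : Type*}

/-- `x` is dominating within `U`: every `k`-set `E` with `x ∈ E ⊆ U` is an edge. -/
def DominatingIn (H : KHypergraph k V) (U : Set V) (x : V) : Prop :=
  ∀ E : Finset V, E.card = k → x ∈ E → (E : Set V) ⊆ U → E ∈ H.edges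

/-- `x` is isolating within `U`: no `k`-set `E` with `x ∈ E ⊆ U` is an edge. -/
def IsolatingIn (H : KHypergraph k V) (U : Set V) (x : V) : Prop :=
  ∀ E : Finset V, E.card = k → x ∈ E → (E : Set V) ⊆ U → E ∉ H.edges

/-- In the enumeration `v` of the vertices, the vertex `v i` is dominating
within `{v j | j ≤ i}`. -/
def DominatingAt (H : KHypergraph k V) {n : ℕ} (v : Fin n ≃ V) (i : Fin n) : Prop :=
  H.DominatingIn (v '' Set.Iic i) (v i)

/-- In the enumeration `v` of the vertices, the vertex `v i` is isolating
within `{v j | j ≤ i}`. -/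
def IsolatingAt (H : KHypergraph k V) {n : ℕ} (v : Fin n ≃ V) (i : Fin n) : Prop :=
  H.IsolatingIn (v '' Set.Iic i) (v i)

/-- The enumeration `v` of the vertices is an elimination order. -/
def IsEliminationOrder (H : KHypergraph k V) {n : ℕ} (v : Fin n ≃ V) : Prop :=
  ∀ i, H.DominatingAt v i ∨ H.IsolatingAt v i

/-- `H` has an elimination order (here `n` is necessarily the number of vertices). -/
def Orderable (H : KHypergraph k V) : Prop :=
  ∃ (n : ℕ) (v : Fin n ≃ V), H.IsEliminationOrder v

/-- The hypergraph `{E ∈ H | E ⊆ V \ {x}}` on the vertex set `V \ {x}`. -/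
def delete (H : KHypergraph k V) (x : V) : KHypergraph k {u : V // u ≠ x} where
  edges := {E | E.map (Function.Embedding.subtype _) ∈ H.edges}
  card_eq E hE := by
    have h := H.card_eq _ hE
    rwa [Finset.card_map] at h

/-- Some set of edges of `H` partitions the vertex set. -/
def HasPerfectMatching (H : KHypergraph k V) : Prop :=
  ∃ M : Finset (Finset V), (∀ E ∈ M, E ∈ H.edges) ∧
    (∀ E ∈ M, ∀ F ∈ M, E ≠ F → Disjoint E F) ∧ ∀ x : V, ∃ E ∈ M, x ∈ E

open Classical in
/-- The number `d_j` of vertices `v i` with `j ≤ i` that are designated dominating. -/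
noncomputable def numDominating (H : KHypergraph k V) {n : ℕ} (v : Fin n ≃ V) (j : Fin n) : ℕ :=
  (Finset.univ.filter fun i : Fin n => j ≤ i ∧ H.DominatingAt v i).card

open Classical in
/-- The number `i_j` of vertices `v i` with `j ≤ i` that are designated isolating.
A vertex that is both dominating and isolating is designated dominating; for `1 ≤ k` these are
exactly the first `k - 1` vertices (or all vertices, if there are fewer). -/
noncomputable def numIsolating (H : KHypergraph k V) {n : ℕ} (v : Fin n ≃ V) (j : Fin n) : ℕ :=
  (Finset.univ.filter fun i : Fin n =>
    j ≤ i ∧ H.IsolatingAt v i ∧ ¬ H.DominatingAt v i).card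

/-- The integer `r_j = (k - 1) d_j - i_j`. -/
noncomputable def balance (H : KHypergraph k V) {n : ℕ} (v : Fin n ≃ V) (j : Fin n) : ℤ :=
  ((k : ℤ) - 1) * H.numDominating v j - H.numIsolating v j

/-- All `k`-tuples of elements of `{0, …, n - 1}`, in lexicographic order. -/
def tuples (n : ℕ) : ℕ → List (List (Fin n))
  | 0 => [[]]
  | k + 1 => (List.finRange n).flatMap fun i => (tuples n k).map fun t => i :: t

open Classical in
/-- The input string `1ⁿ 0 w` of a `k`-hypergraph on `{0, …, n - 1}`, where `w` is its adjacency
tensor: one bit for each of the `nᵏ` tuples `(x₁, …, x_k)` in lexicographic order, telling whether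
`{x₁, …, x_k}` is an edge. For `k = 2` this is the adjacency matrix, row by row. -/
noncomputable def encode (H : Σ n : ℕ, KHypergraph k (Fin n)) : List Bool :=
  List.replicate H.1 true ++
    false :: (tuples H.1 k).map fun t => decide (t.toFinset ∈ H.2.edges)

end KHypergraph

open Classical in
/-- The decision problem `P`, on inputs given as strings by `enc`, is solved by a (multi-stack)
Turing machine in time polynomial in the length of the input string. If the inputs form a subtype,
this is a promise problem: nothing is required on other strings. -/
def DecidableInPolyTime {α Γ : Type} (enc : α → List Γ) (P : α → Prop) : Prop :=
  Nonempty (Turing.TM2ComputableInPolyTime enc Computability.encodeBool fun a => decide (P a))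

/-! Read backwards, an elimination order removes the vertices one by one, each dominating or
isolating among those still present, and a vertex that is dominating or isolating remains so when
other vertices are dropped. Hence a removal order stays one after any vertex is deleted from it, and
a vertex that is dominating or isolating in `V` may always be removed first.

In a perfect matching the first vertex of an edge to be removed is dominating, since an isolating
one lies in no edge with later vertices; so every edge contributes a nonnegative amount to the
balance of every initial segment of the removal order. Conversely, if all these balances are
nonnegative, the first removed vertex is dominating and forms an edge with any `k - 1` others, and
these can be chosen so that the balances of the remaining vertices stay nonnegative.

For the running time, structured programs on stacks of bits are compiled to Turing machines. Each of
`n` rounds tests all `k`-tuples of vertices against the adjacency tensor and then removes all the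
dominating and isolating vertices found, keeping the balance in unary. -/

/-- A store `S` holding one stack of bits for every `k : K`. The store is an abstract type, so that
it can be a structure with named fields. -/
class StackMemory (K : outParam Type) (S : Type) [DecidableEq K] where
  get : S → K → List Bool
  set : K → List Bool → S → S
  get_set : ∀ k l s, get (set k l s) = Function.update (get s) k l
  get_injective : Function.Injective get

/-- Structured programs acting on stacks of bits. -/
inductive StackProg (K : Type) : Type
  | skip : StackProg K
  | push (k : K) (b : Bool) : StackProg K
  | seq (p q : StackProg K) : StackProg K
  /-- pop a bit and continue according to its value, or with `p` if the stack was empty -/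
  | pop (k : K) (p : StackProg K) (q : Bool → StackProg K) : StackProg K
  /-- pop a bit `b` and run `q b`, until the stack is found empty -/
  | loop (k : K) (q : Bool → StackProg K) : StackProg K

namespace StackProg

open StackMemory

section Semantics

variable {K S : Type} [DecidableEq K] [StackMemory K S]

/-- `Run p s T s'`: started in the store `s`, the program `p` ends in `s'` after at most `T`
steps. -/
inductive Run : StackProg K → S → ℕ → S → Prop
  | skip (s : S) : Run .skip s 1 s
  | push (k : K) (b : Bool) (s : S) : Run (.push k b) s 1 (set k (b :: get s k) s)
  | seq {p q : StackProg K} {s₁ s₂ s₃ : S} {T₁ T₂ : ℕ} (h₁ : Run p s₁ T₁ s₂)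
      (h₂ : Run q s₂ T₂ s₃) : Run (.seq p q) s₁ (T₁ + T₂) s₃
  | pop_nil {k : K} {p : StackProg K} {q : Bool → StackProg K} {s s' : S} {T : ℕ}
      (hs : get s k = []) (h : Run p s T s') : Run (.pop k p q) s (1 + T) s'
  | pop_cons {k : K} {p : StackProg K} {q : Bool → StackProg K} {s s' : S} {T : ℕ} {b : Bool}
      {l : List Bool} (hs : get s k = b :: l) (h : Run (q b) (set k l s) T s') :
      Run (.pop k p q) s (1 + T) s'
  | loop_nil {k : K} {q : Bool → StackProg K} {s : S} (hs : get s k = []) : Run (.loop k q) s 1 s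
  | loop_cons {k : K} {q : Bool → StackProg K} {s₁ s₂ s₃ : S} {T₁ T₂ : ℕ} {b : Bool}
      {l : List Bool} (hs : get s₁ k = b :: l) (h₁ : Run (q b) (set k l s₁) T₁ s₂)
      (h₂ : Run (.loop k q) s₂ T₂ s₃) : Run (.loop k q) s₁ (1 + T₁ + T₂) s₃
  | mono {p : StackProg K} {s₁ s₂ : S} {T T' : ℕ} (h : Run p s₁ T s₂) (hT : T ≤ T') :
      Run p s₁ T' s₂

theorem Run.cast {p : StackProg K} {s s' s'' : S} {T T' : ℕ} (h : Run p s T s') (hs : s' = s'')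
    (hT : T ≤ T') : Run p s T' s'' :=
  hs ▸ h.mono hT

end Semantics

section Compilation

variable {K Λ : Type}

/-- The labels of the machine code of a program. -/
def Pos : StackProg K → Type
  | skip => Unit
  | push _ _ => Unit
  | seq p q => p.Pos ⊕ q.Pos
  | pop _ p q => Option (p.Pos ⊕ Σ b : Bool, (q b).Pos)
  | loop _ q => Option (Σ b : Bool, (q b).Pos)

theorem finite_pos : ∀ p : StackProg K, Finite p.Pos
  | skip => inferInstanceAs (Finite Unit)
  | push _ _ => inferInstanceAs (Finite Unit)
  | seq p q =>
    have := p.finite_pos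
    have := q.finite_pos
    inferInstanceAs (Finite (p.Pos ⊕ q.Pos))
  | pop _ p q =>
    have := p.finite_pos
    have := fun b => (q b).finite_pos
    inferInstanceAs (Finite (Option (p.Pos ⊕ Σ b : Bool, (q b).Pos)))
  | loop _ q =>
    have := fun b => (q b).finite_pos
    inferInstanceAs (Finite (Option (Σ b : Bool, (q b).Pos)))

/-- The label at which a program starts. -/
def entry : (p : StackProg K) → p.Pos
  | skip => ()
  | push _ _ => ()
  | seq p _ => Sum.inl p.entry
  | pop _ _ _ => none
  | loop _ _ => none

/-- The statements of the Turing machines produced here; the internal state holds the last bit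
that was popped. -/
abbrev Code (K Λ : Type) : Type := Turing.TM2.Stmt (fun _ : K => Bool) Λ (Option Bool)

/-- The instruction that pops a bit and jumps according to the outcome. -/
def popGoto (k : K) (next : Option Bool → Λ) : Code K Λ :=
  .pop k (fun _ o => o) (.goto next)

/-- The machine code of a program, where `emb` places its labels and `exit` is the label at which
to continue. -/
def code : (p : StackProg K) → (p.Pos → Λ) → Λ → p.Pos → Code K Λ
  | skip, _, exit, _ => .goto fun _ => exit
  | push k b, _, exit, _ => .push k (fun _ => b) (.goto fun _ => exit)
  | seq p q, emb, exit, x =>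
    match x with
    | Sum.inl y => p.code (emb ∘ Sum.inl) (emb (Sum.inr q.entry)) y
    | Sum.inr y => q.code (emb ∘ Sum.inr) exit y
  | pop k p q, emb, exit, x =>
    match x with
    | none => popGoto k fun
        | none => emb (some (Sum.inl p.entry))
        | some b => emb (some (Sum.inr ⟨b, (q b).entry⟩))
    | some (Sum.inl y) => p.code (fun z => emb (some (Sum.inl z))) exit y
    | some (Sum.inr y) => (q y.1).code (fun z => emb (some (Sum.inr ⟨y.1, z⟩))) exit y.2
  | loop k q, emb, exit, x =>
    match x with
    | none => popGoto k fun
        | none => exit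
        | some b => emb (some ⟨b, (q b).entry⟩)
    | some y => (q y.1).code (fun z => emb (some ⟨y.1, z⟩)) (emb none) y.2

variable {S : Type} [DecidableEq K] [StackMemory K S]

/-- The machine `M` gets from label `l` and store `s` to label `l'` and store `s'` in at most `T`
steps, whatever its internal state is. -/
def Leads (M : Λ → Code K Λ) (l : Λ) (s : S) (T : ℕ) (l' : Λ) (s' : S) : Prop :=
  ∀ v : Option Bool, ∃ v' : Option Bool, ∃ t ≤ T,
    (flip bind (Turing.TM2.step M))^[t] (some ⟨some l, v, get s⟩) = some ⟨some l', v', get s'⟩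

namespace Leads

variable {M : Λ → Code K Λ} {l l' l₁ l₂ l₃ : Λ} {s s' s₁ s₂ s₃ : S} {T T' T₁ T₂ : ℕ}

theorem trans (h₁ : Leads M l₁ s₁ T₁ l₂ s₂) (h₂ : Leads M l₂ s₂ T₂ l₃ s₃) :
    Leads M l₁ s₁ (T₁ + T₂) l₃ s₃ := by
  intro v
  obtain ⟨v', t₁, ht₁, e₁⟩ := h₁ v
  obtain ⟨v'', t₂, ht₂, e₂⟩ := h₂ v'
  refine ⟨v'', t₂ + t₁, by omega, ?_⟩
  rw [Function.iterate_add_apply, e₁, e₂]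

theorem mono (h : Leads M l s T l' s') (hT : T ≤ T') : Leads M l s T' l' s' := by
  intro v
  obtain ⟨v', t, ht, e⟩ := h v
  exact ⟨v', t, ht.trans hT, e⟩

theorem of_step (h : ∀ v, ∃ v', Turing.TM2.stepAux (M l) v (get s) = ⟨some l', v', get s'⟩) :
    Leads M l s 1 l' s' := by
  intro v
  obtain ⟨v', e⟩ := h v
  exact ⟨v', 1, le_rfl, congrArg some e⟩

theorem of_goto (hM : M l = .goto fun _ => l') : Leads M l s 1 l' s :=
  of_step fun v => ⟨v, by rw [hM]; rfl⟩

theorem of_push {k : K} {b : Bool} (hM : M l = .push k (fun _ => b) (.goto fun _ => l')) :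
    Leads M l s 1 l' (set k (b :: get s k) s) :=
  of_step fun v => ⟨v, by rw [hM, get_set]; rfl⟩

theorem of_popGoto_nil {k : K} {next : Option Bool → Λ} (hM : M l = popGoto k next)
    (hs : get s k = []) : Leads M l s 1 (next none) s := by
  have hk : Function.update (get s) k [] = get s := Function.update_eq_self_iff.2 hs.symm
  exact of_step fun v => ⟨none, by simp [hM, popGoto, hs, hk]⟩

theorem of_popGoto_cons {k : K} {next : Option Bool → Λ} {b : Bool} {w : List Bool}
    (hM : M l = popGoto k next) (hs : get s k = b :: w) :
    Leads M l s 1 (next (some b)) (set k w s) :=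
  of_step fun v => ⟨some b, by simp [hM, popGoto, hs, get_set]⟩

end Leads

theorem Run.leads {M : Λ → Code K Λ} {p : StackProg K} {s s' : S} {T : ℕ} (h : Run p s T s') :
    ∀ (emb : p.Pos → Λ) (exit : Λ), (∀ x, M (emb x) = p.code emb exit x) →
      Leads M (emb p.entry) s T exit s' := by
  induction h with
  | skip s => exact fun emb exit hM => .of_goto (hM ())
  | push k b s => exact fun emb exit hM => .of_push (hM ())
  | seq _ _ ih₁ ih₂ =>
    exact fun emb exit hM => (ih₁ _ _ fun x => hM (Sum.inl x)).trans
      (ih₂ _ _ fun x => hM (Sum.inr x))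
  | pop_nil hs _ ih =>
    exact fun emb exit hM => (Leads.of_popGoto_nil (hM none) hs).trans
      (ih _ _ fun x => hM (some (Sum.inl x)))
  | pop_cons hs _ ih =>
    exact fun emb exit hM => (Leads.of_popGoto_cons (hM none) hs).trans
      (ih _ _ fun x => hM (some (Sum.inr ⟨_, x⟩)))
  | loop_nil hs => exact fun emb exit hM => .of_popGoto_nil (hM none) hs
  | loop_cons hs _ _ ih₁ ih₂ =>
    exact fun emb exit hM => ((Leads.of_popGoto_cons (hM none) hs).trans
      (ih₁ _ _ fun x => hM (some ⟨_, x⟩))).trans (ih₂ _ _ hM)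
  | mono _ hT ih => exact fun emb exit hM => (ih emb exit hM).mono hT

/-- The machine code of a program that is to be run on its own. The label `none` marks its end;
there the internal state is reset, as Mathlib's halting configurations require. -/
def program (p : StackProg K) : Option p.Pos → Code K (Option p.Pos)
  | none => .load (fun _ => none) .halt
  | some x => p.code some none x

/-- The Turing machine executing a program, with one stack for input and output. -/
noncomputable def machine [Fintype K] (p : StackProg K) (io : K) : Turing.FinTM2 :=
  have := p.finite_pos
  { K := K
    k₀ := io
    k₁ := io
    Γ := fun _ => Bool
    Λ := Option p.Pos
    ΛFin := Fintype.ofFinite _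
    main := some p.entry
    σ := Option Bool
    initialState := none
    Γk₀Fin := inferInstanceAs (Fintype Bool)
    m := p.program }

variable [Fintype K]

theorem initList_machine (p : StackProg K) (io : K) (l : List Bool) :
    Turing.initList (p.machine io) l =
      (⟨some (some p.entry), none, Function.update (fun _ => []) io l⟩ :
        Turing.TM2.Cfg (fun _ : K => Bool) (Option p.Pos) (Option Bool)) := by
  refine congrArg (Turing.TM2.Cfg.mk _ _) (funext fun (k : K) => ?_)
  by_cases hk : k = io
  · subst hk
    exact (dif_pos rfl).trans
      (Function.update_self (β := fun _ => List Bool) k l fun _ => []).symm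
  · exact (dif_neg hk).trans
      (Function.update_of_ne (β := fun _ => List Bool) hk l fun _ => []).symm

theorem haltList_machine (p : StackProg K) (io : K) (l : List Bool) :
    Turing.haltList (p.machine io) l =
      (⟨none, none, Function.update (fun _ => []) io l⟩ :
        Turing.TM2.Cfg (fun _ : K => Bool) (Option p.Pos) (Option Bool)) :=
  congrArg (Turing.TM2.Cfg.mk none none)
    (congrArg Turing.TM2.Cfg.stk (initList_machine p io l))

theorem exists_iterate_step_machine {p : StackProg K} {io : K} {s s' : S} {T : ℕ}
    {l l' : List Bool} (hs : get s = Function.update (fun _ => []) io l)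
    (hs' : get s' = Function.update (fun _ => []) io l') (h : Run p s T s') :
    ∃ t ≤ T + 1, (flip bind (p.machine io).step)^[t] (some (Turing.initList (p.machine io) l)) =
      some (Turing.haltList (p.machine io) l') := by
  obtain ⟨v, t, ht, e⟩ := h.leads (M := p.program) some none (fun _ => rfl) none
  rw [initList_machine, haltList_machine, ← hs, ← hs']
  refine ⟨1 + t, by omega, ?_⟩
  rw [Function.iterate_add_apply]
  exact congrArg (flip bind (Turing.TM2.step p.program)) e

end Compilation

theorem decidableInPolyTime {K S α : Type} [DecidableEq K] [Finite K] [StackMemory K S]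
    {enc : α → List Bool} {P : α → Prop} (p : StackProg K) (io : K) (time : Polynomial ℕ)
    (h : ∀ a, ∃ s s' : S, get s = Function.update (fun _ => []) io (enc a) ∧
      get s' = Function.update (fun _ => []) io (open Classical in [decide (P a)]) ∧
      Run p s (time.eval (enc a).length) s') :
    DecidableInPolyTime enc P := by
  cases nonempty_fintype K
  choose s s' hs hs' hrun using h
  choose t ht hiter using fun a => exists_iterate_step_machine (hs a) (hs' a) (hrun a)
  refine ⟨{ tm := p.machine io
            inputAlphabet := Equiv.refl Bool
            outputAlphabet := Equiv.refl Bool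
            time := time + 1
            outputsFun := fun a => ⟨⟨t a, ?_⟩, by simpa using ht a⟩ }⟩
  have hmap : (enc a).map (Equiv.refl Bool).invFun = enc a := List.map_id _
  exact (congrArg (fun l => (flip bind (p.machine io).step)^[t a]
    (some (Turing.initList (p.machine io) l))) hmap).trans (hiter a)

section Library

variable {K S : Type} [DecidableEq K] [StackMemory K S]

/-- Repeat a program a fixed number of times. -/
def rep : ℕ → StackProg K → StackProg K
  | 0, _ => skip
  | i + 1, p => seq p (rep i p)

/-- Empty a stack. -/
def drop (a : K) : StackProg K := loop a fun _ => skip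

/-- Move the content of a stack onto another one, in reverse order. -/
def move (a b : K) : StackProg K := loop a fun x => push b x

/-- Move the content of a stack `a` onto `b`, and its image under `f` onto `c`, both in reverse
order. -/
def fork (a b c : K) (f : Bool → Bool) : StackProg K :=
  loop a fun x => seq (push b x) (push c (f x))

/-- Push a bit onto a stack `c` for every bit `b` on a stack `a`, which is emptied. -/
def count (a c : K) (b : Bool) : StackProg K := loop a fun x => if x = b then push c true else skip

/-- Record on a stack `c` whether a stack `a` is empty, and empty it. -/
def testNil (a c : K) : StackProg K := pop a (push c true) fun _ => seq (drop a) (push c false)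

theorem Run.rep {p : StackProg K} {s : ℕ → S} {T : ℕ} (j : ℕ)
    (h : ∀ i < j, Run p (s i) T (s (i + 1))) : Run (rep j p) (s 0) (j * T + 1) (s j) := by
  induction j generalizing s with
  | zero => exact (Run.skip _).mono le_add_self
  | succ j ih =>
    refine ((h 0 j.succ_pos).seq (ih (s := fun i => s (i + 1)) fun i hi => h _ ?_)).mono ?_
    · exact Nat.succ_lt_succ hi
    · rw [Nat.succ_mul]
      omega

theorem run_drop (a : K) (s : S) : Run (drop a) s (2 * (get s a).length + 1) (set a [] s) := by
  generalize hl : get s a = l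
  induction l generalizing s with
  | nil =>
    refine (Run.loop_nil hl).cast (get_injective ?_) le_add_self
    rw [get_set, Function.update_eq_self_iff.2 hl.symm]
  | cons x l ih =>
    refine (Run.loop_cons hl (Run.skip _) (ih (set a l s) ?_)).cast (get_injective ?_) ?_
    · rw [get_set, Function.update_self]
    · simp only [get_set, Function.update_idem]
    · rw [List.length_cons]
      omega

theorem run_move {a b : K} (hab : a ≠ b) (s : S) : Run (move a b) s (2 * (get s a).length + 1)
    (set b ((get s a).reverse ++ get s b) (set a [] s)) := by
  generalize hl : get s a = l
  induction l generalizing s with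
  | nil =>
    refine (Run.loop_nil hl).cast (get_injective (funext fun j => ?_)) le_add_self
    simp only [get_set, Function.update_apply]
    grind
  | cons x l ih =>
    refine (Run.loop_cons hl (Run.push _ _ _) (ih _ ?_)).cast
      (get_injective (funext fun j => ?_)) ?_
    · simp only [get_set, Function.update_self, Function.update_of_ne hab]
    · simp only [get_set, Function.update_apply]
      grind
    · rw [List.length_cons]
      omega

theorem run_fork {a b c : K} (hab : a ≠ b) (hac : a ≠ c) (hbc : b ≠ c) (f : Bool → Bool) (s : S) :
    Run (fork a b c f) s (3 * (get s a).length + 1)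
      (set c (((get s a).map f).reverse ++ get s c)
        (set b ((get s a).reverse ++ get s b) (set a [] s))) := by
  generalize hl : get s a = l
  induction l generalizing s with
  | nil =>
    refine (Run.loop_nil hl).cast (get_injective (funext fun j => ?_)) le_add_self
    simp only [get_set, Function.update_apply]
    grind
  | cons x l ih =>
    refine (Run.loop_cons hl (Run.seq (Run.push _ _ _) (Run.push _ _ _)) (ih _ ?_)).cast
      (get_injective (funext fun j => ?_)) ?_
    · simp only [get_set, Function.update_self, Function.update_of_ne hab,
        Function.update_of_ne hac]
    · simp only [get_set, Function.update_apply]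
      grind
    · rw [List.length_cons]
      omega

theorem run_count {a c : K} (hac : a ≠ c) (b : Bool) (s : S) :
    Run (count a c b) s (2 * (get s a).length + 1)
      (set c (List.replicate ((get s a).count b) true ++ get s c) (set a [] s)) := by
  generalize hl : get s a = l
  induction l generalizing s with
  | nil =>
    refine (Run.loop_nil hl).cast (get_injective (funext fun j => ?_)) le_add_self
    simp only [get_set, Function.update_apply]
    grind
  | cons x l ih =>
    have hstep : Run (if x = b then push c true else skip) (set a l s) 1
        (set c (List.replicate ([x].count b) true ++ get s c) (set a l s)) := by
      by_cases hx : x = b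
      · rw [if_pos hx, hx, List.count_singleton_self]
        exact (Run.push _ _ _).cast (by rw [get_set, Function.update_of_ne hac.symm]; rfl) le_rfl
      · rw [if_neg hx, List.count_singleton]
        refine (Run.skip _).cast (get_injective (funext fun j => ?_)) le_rfl
        simp only [get_set, Function.update_apply]
        grind
    refine (Run.loop_cons hl hstep (ih _ ?_)).cast (get_injective (funext fun j => ?_)) ?_
    · simp only [get_set, Function.update_self, Function.update_of_ne hac]
    · simp only [get_set, Function.update_apply]
      have hcount : (x :: l).count b = l.count b + [x].count b := by
        rw [← List.singleton_append, List.count_append, add_comm]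
      rw [hcount, List.replicate_add]
      grind
    · rw [List.length_cons]
      omega

theorem run_testNil {a c : K} (hac : a ≠ c) (s : S) :
    Run (testNil a c) s (2 * (get s a).length + 3)
      (set c ((get s a).isEmpty :: get s c) (set a [] s)) := by
  generalize hl : get s a = l
  cases l with
  | nil =>
    refine (Run.pop_nil hl (Run.push _ _ _)).cast (get_injective (funext fun j => ?_)) (by omega)
    simp only [get_set, Function.update_apply]
    grind
  | cons x l =>
    refine (Run.pop_cons hl ((run_drop _ _).seq (Run.push _ _ _))).cast
      (get_injective (funext fun j => ?_)) ?_
    · simp only [get_set, Function.update_apply]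
      grind
    · rw [get_set, Function.update_self, List.length_cons]
      omega

end Library

end StackProg

namespace KHypergraph

section Peeling

variable {k : ℕ} {V : Type*} {H : KHypergraph k V}

/-- `x` is dominating (if `δ`) or isolating (if not) within `U`. -/
def RemovableAs (H : KHypergraph k V) (U : Set V) (x : V) (δ : Bool) : Prop :=
  if δ then H.DominatingIn U x else H.IsolatingIn U x

theorem removableAs_iff {U : Set V} {x : V} {δ : Bool} :
    H.RemovableAs U x δ ↔
      ∀ E : Finset V, E.card = k → x ∈ E → (E : Set V) ⊆ U → (E ∈ H.edges ↔ δ = true) := by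
  cases δ
  · simp only [RemovableAs, IsolatingIn, Bool.false_eq_true, if_false, iff_false]
  · simp only [RemovableAs, DominatingIn, if_true, iff_true]

theorem RemovableAs.mono {U U' : Set V} {x : V} {δ : Bool} (h : H.RemovableAs U x δ)
    (hU : U' ⊆ U) : H.RemovableAs U' x δ :=
  removableAs_iff.2 fun E hE hx hEU => removableAs_iff.1 h E hE hx (hEU.trans hU)

theorem exists_removableAs {U : Set V} {x : V} :
    (∃ δ, H.RemovableAs U x δ) ↔ H.DominatingIn U x ∨ H.IsolatingIn U x := by
  simp [RemovableAs, or_comm]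

/-- The set of vertices occurring in a list of designated vertices. -/
def vertexSet (L : List (V × Bool)) : Set V := {x | x ∈ L.map Prod.fst}

theorem vertexSet_cons (e : V × Bool) (L : List (V × Bool)) :
    vertexSet (e :: L) = insert e.1 (vertexSet L) := by
  ext x
  simp [vertexSet]

theorem vertexSet_mono {L L' : List (V × Bool)} (h : L ⊆ L') : vertexSet L ⊆ vertexSet L' :=
  fun _ hx => List.map_subset _ h hx

/-- Removing the designated vertices of a list one after the other, each of them dominating or
isolating as designated when it is removed, leads from `U` to `W`. -/
def Peels (H : KHypergraph k V) : Set V → List (V × Bool) → Set V → Prop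
  | U, [], W => U = W
  | U, e :: L, W => e.1 ∈ U ∧ H.RemovableAs U e.1 e.2 ∧ H.Peels (U \ {e.1}) L W

theorem peels_append {L L' : List (V × Bool)} {U X : Set V} :
    H.Peels U (L ++ L') X ↔ ∃ W, H.Peels U L W ∧ H.Peels W L' X := by
  induction L generalizing U with
  | nil => simp [Peels]
  | cons e L ih => simp [Peels, ih, and_assoc]

theorem Peels.vertexSet_subset {L : List (V × Bool)} {U W : Set V} (h : H.Peels U L W) :
    vertexSet L ⊆ U := by
  induction L generalizing U with
  | nil => simp [vertexSet]
  | cons e L ih =>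
    rw [vertexSet_cons]
    exact Set.insert_subset h.1 ((ih h.2.2).trans Set.sdiff_subset)

theorem Peels.eq_sdiff {L : List (V × Bool)} {U W : Set V} (h : H.Peels U L W) :
    W = U \ vertexSet L := by
  induction L generalizing U with
  | nil => simpa [vertexSet] using h.symm
  | cons e L ih => rw [ih h.2.2, vertexSet_cons, Set.sdiff_sdiff, Set.singleton_union]

theorem Peels.vertexSet_eq {L : List (V × Bool)} {U : Set V} (h : H.Peels U L ∅) :
    vertexSet L = U :=
  h.vertexSet_subset.antisymm (Set.sdiff_eq_empty.1 h.eq_sdiff.symm)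

theorem Peels.nodup {L : List (V × Bool)} {U W : Set V} (h : H.Peels U L W) :
    (L.map Prod.fst).Nodup := by
  induction L generalizing U with
  | nil => exact List.nodup_nil
  | cons e L ih =>
    exact List.nodup_cons.2 ⟨fun he => (h.2.2.vertexSet_subset he).2 rfl, ih h.2.2⟩

theorem Peels.vertexSet_cons {e : V × Bool} {L : List (V × Bool)} (he : e.1 ∉ vertexSet L)
    (hr : H.RemovableAs (vertexSet (e :: L)) e.1 e.2) (h : H.Peels (vertexSet L) L ∅) :
    H.Peels (vertexSet (e :: L)) (e :: L) ∅ := by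
  refine ⟨List.mem_cons_self, hr, ?_⟩
  rwa [KHypergraph.vertexSet_cons, Set.insert_sdiff_self_of_notMem he]

theorem Peels.sublist {L L' : List (V × Bool)} {U W : Set V} (h : H.Peels U L W)
    (hL : L'.Sublist L) : H.Peels (vertexSet L') L' ∅ := by
  induction hL generalizing U with
  | slnil => simp [vertexSet, Peels]
  | cons e _ ih => exact ih h.2.2
  | cons_cons e hL ih =>
    have hsub := (vertexSet_mono (hL.cons_cons e).subset).trans h.vertexSet_subset
    have he := (List.nodup_cons.1 h.nodup).1
    exact .vertexSet_cons (fun h' => he (vertexSet_mono hL.subset h')) (h.2.1.mono hsub) (ih h.2.2)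

theorem Peels.exists_of_subset {L : List (V × Bool)} {U S : Set V} (h : H.Peels U L ∅)
    (hS : S ⊆ U) : ∃ L', H.Peels S L' ∅ := by
  classical
  have hset : vertexSet (L.filter fun e => e.1 ∈ S) = S := by
    ext x
    have hx : x ∈ S → x ∈ vertexSet L := fun hx => h.vertexSet_eq.ge (hS hx)
    simpa [vertexSet] using hx
  exact ⟨_, hset ▸ h.sublist List.filter_sublist⟩

theorem peels_of_forall {L : List (V × Bool)} {U : Set V} (hnd : (L.map Prod.fst).Nodup)
    (h : ∀ e ∈ L, e.1 ∈ U ∧ H.RemovableAs U e.1 e.2) : H.Peels U L (U \ vertexSet L) := by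
  induction L generalizing U with
  | nil => simp [vertexSet, Peels]
  | cons e L ih =>
    obtain ⟨he, hnd'⟩ := List.nodup_cons.1 hnd
    obtain ⟨⟨heU, her⟩, hL⟩ := List.forall_mem_cons.1 h
    rw [vertexSet_cons, ← Set.singleton_union, ← Set.sdiff_sdiff]
    refine ⟨heU, her, ih hnd' fun e' he' => ⟨⟨(hL e' he').1, fun hee => he ?_⟩,
      (hL e' he').2.mono Set.sdiff_subset⟩⟩
    exact Set.mem_singleton_iff.1 hee ▸ List.mem_map_of_mem he'

section Orderable

open Classical in
/-- The order in which the vertices are removed along an elimination order, with their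
designations. -/
noncomputable def peelingOf (H : KHypergraph k V) {n : ℕ} (v : Fin n ≃ V) : List (V × Bool) :=
  (List.finRange n).reverse.map fun i => (v i, decide (H.DominatingAt v i))

open Classical in
theorem IsEliminationOrder.removableAs {n : ℕ} {v : Fin n ≃ V} (h : H.IsEliminationOrder v)
    (i : Fin n) : H.RemovableAs (v '' Set.Iic i) (v i) (decide (H.DominatingAt v i)) := by
  by_cases hd : H.DominatingAt v i
  · rw [decide_eq_true hd]
    exact hd
  · rw [decide_eq_false hd]
    exact (h i).resolve_left hd

theorem IsEliminationOrder.peels {n : ℕ} {v : Fin n ≃ V} (h : H.IsEliminationOrder v) :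
    H.Peels Set.univ (H.peelingOf v) ∅ := by
  classical
  have hpeels : ∀ I : List (Fin n), I.Pairwise (· > ·) →
      H.Peels (v '' {i | i ∈ I}) (I.map fun i => (v i, decide (H.DominatingAt v i))) ∅ := by
    intro I hI
    induction I with
    | nil => simp [Peels]
    | cons i I ih =>
      obtain ⟨hlt, hI⟩ := List.pairwise_cons.1 hI
      have hset : {j | j ∈ i :: I} = insert i {j | j ∈ I} := by
        ext
        simp
      refine ⟨⟨i, List.mem_cons_self, rfl⟩, (h.removableAs i).mono (Set.image_mono ?_), ?_⟩
      · rw [hset]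
        exact Set.insert_subset (Set.mem_Iic.2 le_rfl) fun j hj => (hlt j hj).le
      · rw [hset, Set.image_insert_eq, Set.insert_sdiff_self_of_notMem]
        · exact ih hI
        · rintro ⟨j, hj, hji⟩
          exact (hlt j hj).ne (v.injective hji)
  have hall : v '' {i | i ∈ (List.finRange n).reverse} = Set.univ := by simp
  exact hall ▸ hpeels _ (List.pairwise_reverse.2 (List.pairwise_lt_finRange n))

theorem Peels.removableAs_getElem {L : List (V × Bool)} {U W : Set V} (h : H.Peels U L W) {p : ℕ}
    (hp : p < L.length) : H.RemovableAs (vertexSet (L.drop p)) L[p].1 L[p].2 := by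
  have hdrop := h.sublist (List.drop_sublist p L)
  rw [List.drop_eq_getElem_cons hp] at hdrop ⊢
  exact hdrop.2.1

theorem Peels.orderable {L : List (V × Bool)} (h : H.Peels Set.univ L ∅) : H.Orderable := by
  classical
  have hmem : ∀ x, x ∈ L.map Prod.fst := fun x => h.vertexSet_eq.ge (Set.mem_univ x)
  refine ⟨_, Fin.revPerm.trans (h.nodup.getEquivOfForallMemList _ hmem), fun i => ?_⟩
  have hi : (i.rev : ℕ) < L.length := by simpa using i.rev.2
  have hlater : Fin.revPerm.trans (h.nodup.getEquivOfForallMemList _ hmem) '' Set.Iic i ⊆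
      vertexSet (L.drop i.rev) := by
    rintro _ ⟨j, hj, rfl⟩
    have hij : (i.rev : ℕ) ≤ j.rev := Fin.rev_le_rev.2 hj
    have hget : (L.map Prod.fst)[(j.rev : ℕ)] ∈ (L.map Prod.fst).drop i.rev :=
      List.mem_drop_iff_getElem.2 ⟨j.rev - i.rev, by omega, by simp only [Nat.add_sub_cancel' hij]⟩
    rwa [← List.map_drop] at hget
  have hx : Fin.revPerm.trans (h.nodup.getEquivOfForallMemList _ hmem) i = L[(i.rev : ℕ)].1 := by
    simp
  have hr := (h.removableAs_getElem hi).mono hlater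
  rw [← hx] at hr
  exact exists_removableAs.1 ⟨_, hr⟩

theorem orderable_iff_exists_peels : H.Orderable ↔ ∃ L, H.Peels Set.univ L ∅ :=
  ⟨fun ⟨_, _, hv⟩ => ⟨_, hv.peels⟩, fun ⟨_, hL⟩ => hL.orderable⟩

theorem Orderable.exists_removableAs (h : H.Orderable) {S : Set V} (hS : S.Nonempty) :
    ∃ x ∈ S, ∃ δ, H.RemovableAs S x δ := by
  obtain ⟨L, hL⟩ := orderable_iff_exists_peels.1 h
  obtain ⟨_ | ⟨e, L'⟩, hL'⟩ := hL.exists_of_subset (Set.subset_univ S)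
  · exact absurd hL' hS.ne_empty
  · exact ⟨e.1, hL'.1, e.2, hL'.2.1⟩

theorem orderable_of_card_le [Finite V] (h : Nat.card V ≤ k) : H.Orderable := by
  classical
  have := Fintype.ofFinite V
  have huniv : ∀ E : Finset V, E.card = k → E = Finset.univ := fun E hE =>
    Finset.eq_univ_of_card E
      (le_antisymm (Finset.card_le_univ E) (hE ▸ Nat.card_eq_fintype_card (α := V) ▸ h))
  obtain ⟨L, hL⟩ : ∃ L : List (V × Bool),
      L = Finset.univ.toList.map fun x => (x, decide (Finset.univ ∈ H.edges)) := ⟨_, rfl⟩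
  have hfst : L.map Prod.fst = Finset.univ.toList := by
    rw [hL, List.map_map]
    exact List.map_id _
  have hset : vertexSet L = Set.univ := Set.eq_univ_of_forall fun x =>
    show x ∈ L.map Prod.fst from hfst ▸ Finset.mem_toList.2 (Finset.mem_univ x)
  have hpeels : H.Peels Set.univ L (Set.univ \ vertexSet L) := by
    refine peels_of_forall (hfst ▸ Finset.nodup_toList _) fun e he => ⟨trivial, ?_⟩
    obtain ⟨x, -, rfl⟩ := List.mem_map.1 (hL ▸ he)
    exact removableAs_iff.2 fun E hE _ _ => by rw [huniv E hE, decide_eq_true_iff]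
  rw [hset, Set.sdiff_self] at hpeels
  exact hpeels.orderable

end Orderable

section Delete

variable {x : V}

theorem removableAs_delete {U : Set {u : V // u ≠ x}} {y : {u : V // u ≠ x}} {δ : Bool} :
    (H.delete x).RemovableAs U y δ ↔ H.RemovableAs (Subtype.val '' U) y δ := by
  classical
  simp only [removableAs_iff]
  constructor
  · intro h E hE hy hEU
    have hmap : (E.subtype (· ≠ x)).map (Function.Embedding.subtype _) = E :=
      Finset.subtype_map_of_mem fun z hz => (hEU hz).elim fun w hw => hw.2 ▸ w.2
    rw [← hmap] at hE hy hEU ⊢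
    rw [Finset.coe_map] at hEU
    exact h _ (by rwa [Finset.card_map] at hE) ((Finset.mem_map' _).1 hy)
      ((Set.image_subset_image_iff Subtype.val_injective).1 hEU)
  · intro h E hE hy hEU
    refine h (E.map (Function.Embedding.subtype _)) (by rwa [Finset.card_map])
      (Finset.mem_map_of_mem _ hy) ?_
    rw [Finset.coe_map]
    exact Set.image_mono hEU

theorem peels_delete {L : List ({u : V // u ≠ x} × Bool)} {U W : Set {u : V // u ≠ x}} :
    (H.delete x).Peels U L W ↔
      H.Peels (Subtype.val '' U) (L.map (Prod.map Subtype.val id)) (Subtype.val '' W) := by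
  induction L generalizing U with
  | nil => exact (Set.image_injective.2 Subtype.val_injective).eq_iff.symm
  | cons e L ih =>
    simp only [Peels, List.map_cons, Prod.map_fst, Prod.map_snd, id, ih, removableAs_delete,
      Subtype.val_injective.mem_set_image, Set.image_sdiff Subtype.val_injective,
      Set.image_singleton]

theorem image_val_univ_delete :
    Subtype.val '' (Set.univ : Set {u : V // u ≠ x}) = Set.univ \ {x} := by
  ext
  simp

theorem Orderable.delete (h : H.Orderable) (x : V) : (H.delete x).Orderable := by
  obtain ⟨L, hL⟩ := orderable_iff_exists_peels.1 h
  obtain ⟨L', hL'⟩ := hL.exists_of_subset (Set.subset_univ (Set.univ \ {x}))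
  obtain ⟨L'', rfl⟩ : L' ∈
      Set.range (List.map (Prod.map (Subtype.val : {u : V // u ≠ x} → V) id)) := by
    rw [Set.range_list_map]
    exact fun e he => ⟨(⟨e.1, (hL'.vertexSet_subset (List.mem_map_of_mem he)).2⟩, e.2), rfl⟩
  refine Peels.orderable (L := L'') (peels_delete.2 ?_)
  rwa [image_val_univ_delete, Set.image_empty]

theorem orderable_iff_delete (hx : H.DominatingIn Set.univ x ∨ H.IsolatingIn Set.univ x) :
    H.Orderable ↔ (H.delete x).Orderable := by
  refine ⟨fun h => h.delete x, fun h => ?_⟩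
  obtain ⟨δ, hδ⟩ := exists_removableAs.2 hx
  obtain ⟨L, hL⟩ := orderable_iff_exists_peels.1 h
  have hL' := peels_delete.1 hL
  rw [image_val_univ_delete, Set.image_empty] at hL'
  exact Peels.orderable (L := (x, δ) :: _) ⟨Set.mem_univ x, hδ, hL'⟩

theorem orderable_iff_exists_delete [Nonempty V] :
    H.Orderable ↔ ∃ x : V, (H.DominatingIn Set.univ x ∨ H.IsolatingIn Set.univ x) ∧
      (H.delete x).Orderable := by
  refine ⟨fun h => ?_, fun ⟨x, hx, h⟩ => (orderable_iff_delete hx).2 h⟩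
  obtain ⟨x, -, hx⟩ := h.exists_removableAs Set.univ_nonempty
  exact ⟨x, KHypergraph.exists_removableAs.1 hx, h.delete x⟩

end Delete

end Peeling

section Matching

variable {k : ℕ} {V : Type*} {H : KHypergraph k V}

/-- The contribution of a vertex with designation `δ` to the balance. -/
def weight (k : ℕ) (δ : Bool) : ℤ := if δ then k - 1 else -1

/-- The balance of a list of designated vertices. -/
def totalWeight (k : ℕ) (L : List (V × Bool)) : ℤ := (L.map fun e => weight k e.2).sum

theorem totalWeight_cons (e : V × Bool) (L : List (V × Bool)) :
    totalWeight k (e :: L) = weight k e.2 + totalWeight k L := by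
  simp only [totalWeight, List.map_cons, List.sum_cons]

/-- A balance that starts at `s` and is updated along `L` never becomes negative. -/
def Balanced (k : ℕ) (s : ℤ) (L : List (V × Bool)) : Prop :=
  ∀ P, P <+: L → 0 ≤ s + totalWeight k P

theorem Balanced.nonneg {s : ℤ} {L : List (V × Bool)} (h : Balanced k s L) : 0 ≤ s := by
  simpa [totalWeight] using h [] List.nil_prefix

theorem balanced_nil {s : ℤ} : Balanced k s ([] : List (V × Bool)) ↔ 0 ≤ s := by
  simp [Balanced, totalWeight]

theorem balanced_cons {s : ℤ} {e : V × Bool} {L : List (V × Bool)} :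
    Balanced k s (e :: L) ↔ 0 ≤ s ∧ Balanced k (s + weight k e.2) L := by
  refine ⟨fun h => ⟨h.nonneg, fun P hP => ?_⟩, fun ⟨hs, h⟩ P hP => ?_⟩
  · rw [add_assoc, ← totalWeight_cons]
    exact h _ ((List.prefix_cons_inj e).2 hP)
  · rcases List.prefix_cons_iff.1 hP with rfl | ⟨P, rfl, hPL⟩
    · simpa [totalWeight] using hs
    · rw [totalWeight_cons, ← add_assoc]
      exact h P hPL

/-- A set of pairwise disjoint edges with union `S`. -/
structure IsMatchingOn (H : KHypergraph k V) (M : Finset (Finset V)) (S : Set V) : Prop where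
  mem_edges : ∀ E ∈ M, E ∈ H.edges
  pairwiseDisjoint : (M : Set (Finset V)).PairwiseDisjoint id
  exists_mem_iff : ∀ x, (∃ E ∈ M, x ∈ E) ↔ x ∈ S

theorem hasPerfectMatching_iff_exists_isMatchingOn :
    H.HasPerfectMatching ↔ ∃ M, H.IsMatchingOn M Set.univ :=
  exists_congr fun _ => ⟨fun ⟨hM, hdisj, hcov⟩ =>
      ⟨hM, fun E hE F hF => hdisj E hE F hF, fun x => iff_true_intro (hcov x)⟩,
    fun h => ⟨h.mem_edges, fun _ hE _ hF => h.pairwiseDisjoint hE hF,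
      fun x => (h.exists_mem_iff x).2 trivial⟩⟩

theorem IsMatchingOn.insert [DecidableEq V] {M : Finset (Finset V)} {S : Set V} {E : Finset V}
    (h : H.IsMatchingOn M S) (hE : E ∈ H.edges) (hdisj : ∀ x ∈ E, x ∉ S) :
    H.IsMatchingOn (Insert.insert E M) (↑E ∪ S) where
  mem_edges := Finset.forall_mem_insert _ _ _ |>.2 ⟨hE, h.mem_edges⟩
  pairwiseDisjoint := by
    rw [Finset.coe_insert]
    exact h.pairwiseDisjoint.insert fun F hF _ =>
      Finset.disjoint_left.2 fun x hx hxF => hdisj x hx ((h.exists_mem_iff x).1 ⟨F, hF, hxF⟩)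
  exists_mem_iff x := by
    rw [Finset.exists_mem_insert, h.exists_mem_iff, Set.mem_union, Finset.mem_coe]

section Sufficiency

/- The vertices that are taken out are chosen greedily, isolating ones first: a dominating vertex is
only taken if all later vertices are taken as well, so that the balance never drops below `b`. -/
theorem Balanced.exists_take {L : List (V × Bool)} {c : ℕ} {b : ℤ} (hb : 0 ≤ b) (hk : 1 ≤ k)
    (h : Balanced k (b + c) L) (hc : c ≤ L.length) :
    ∃ t r : List (V × Bool), t.length = c ∧ r.Sublist L ∧ L.Perm (t ++ r) ∧ Balanced k b r := by
  induction L generalizing c b with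
  | nil => exact ⟨[], [], (Nat.le_zero.1 hc).symm, .refl _, .refl _, balanced_nil.2 hb⟩
  | cons e L ih =>
    obtain ⟨y, δ⟩ := e
    have htail := (balanced_cons.1 h).2
    rcases c with _ | c
    · exact ⟨[], _, rfl, .refl _, .refl _, by simpa using h⟩
    cases δ with
    | true =>
      rcases Nat.lt_or_ge L.length (c + 1) with hlt | hge
      · exact ⟨(y, true) :: L, [], le_antisymm hlt hc, List.nil_sublist _, by simp,
          balanced_nil.2 hb⟩
      have htail' : Balanced k (b + weight k true + (c + 1 : ℕ)) L := by
        rwa [add_right_comm]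
      have hweight : 0 ≤ weight k true := by
        simp only [weight, if_true]
        omega
      obtain ⟨t, r, ht, hr, hperm, hbr⟩ := ih (add_nonneg hb hweight) htail' hge
      exact ⟨t, (y, true) :: r, ht, hr.cons_cons _, (hperm.cons _).trans List.perm_middle.symm,
        balanced_cons.2 ⟨hb, hbr⟩⟩
    | false =>
      have htail' : Balanced k (b + c) L := by
        simpa [weight, add_assoc] using htail
      obtain ⟨t, r, ht, hr, hperm, hbr⟩ := ih hb htail' (Nat.le_of_succ_le_succ hc)
      exact ⟨(y, false) :: t, r, congrArg Nat.succ ht, hr.cons _, hperm.cons _, hbr⟩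

theorem Balanced.exists_eq_cons_true {L : List (V × Bool)} (h : Balanced k 0 L) (hL : L ≠ []) :
    ∃ x L', L = (x, true) :: L' ∧ Balanced k ((k : ℤ) - 1) L' := by
  obtain ⟨⟨x, δ⟩, L', rfl⟩ := List.exists_cons_of_ne_nil hL
  have hb := (balanced_cons.1 h).2
  cases δ with
  | true => exact ⟨x, L', rfl, by simpa [weight] using hb⟩
  | false => exact absurd hb.nonneg (by simp [weight])

theorem IsMatchingOn.insert_of_peels [DecidableEq V] {x : V} {L t r : List (V × Bool)} {U : Set V}
    {M : Finset (Finset V)} (hM : H.IsMatchingOn M (vertexSet r))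
    (hp : H.Peels U ((x, true) :: L) ∅) (hperm : L.Perm (t ++ r)) (ht : t.length + 1 = k) :
    H.IsMatchingOn (Insert.insert (x :: t.map Prod.fst).toFinset M) U := by
  have hpermE : (x :: L.map Prod.fst).Perm ((x :: t.map Prod.fst) ++ r.map Prod.fst) := by
    simpa using (hperm.map Prod.fst).cons x
  obtain ⟨hnd, -, hdisj⟩ := List.nodup_append.1 (hpermE.nodup_iff.1 hp.nodup)
  have hU : U = ↑(x :: t.map Prod.fst).toFinset ∪ vertexSet r := by
    ext y
    rw [← hp.vertexSet_eq, Set.mem_union, Finset.mem_coe, List.mem_toFinset]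
    exact hpermE.mem_iff.trans List.mem_append
  have hcard : (x :: t.map Prod.fst).toFinset.card = k := by
    rw [List.toFinset_card_of_nodup hnd, List.length_cons, List.length_map, ht]
  have hedge : (x :: t.map Prod.fst).toFinset ∈ H.edges :=
    (removableAs_iff.1 hp.2.1 _ hcard (by simp) (hU ▸ Set.subset_union_left)).2 rfl
  rw [hU]
  exact hM.insert hedge fun y hy hyr => hdisj y (List.mem_toFinset.1 hy) y hyr rfl

theorem Peels.exists_isMatchingOn (m : ℕ) {L : List (V × Bool)} {U : Set V} (hp : H.Peels U L ∅)
    (hlen : L.length = k * m) (hb : Balanced k 0 L) : ∃ M, H.IsMatchingOn M U := by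
  classical
  induction m generalizing L U with
  | zero =>
    obtain rfl := List.eq_nil_of_length_eq_zero hlen
    obtain rfl : U = ∅ := hp
    exact ⟨∅, by simp, by simp, by simp⟩
  | succ m ih =>
    rcases Nat.eq_zero_or_pos k with rfl | hk
    · exact ih hp (by simpa using hlen) hb
    obtain ⟨x, L, rfl, hb⟩ := hb.exists_eq_cons_true
      (List.ne_nil_of_length_pos (hlen ▸ Nat.mul_pos hk m.succ_pos))
    rw [List.length_cons, Nat.mul_succ] at hlen
    obtain ⟨t, r, ht, hr, hperm, hbr⟩ := Balanced.exists_take (c := k - 1) le_rfl hk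
      (by rwa [zero_add, Nat.cast_sub hk, Nat.cast_one]) (by omega)
    have hlenr : r.length = k * m := by
      have := hperm.length_eq
      rw [List.length_append] at this
      omega
    obtain ⟨M, hM⟩ := ih (hp.2.2.sublist hr) hlenr hbr
    exact ⟨_, hM.insert_of_peels hp hperm (by omega)⟩

end Sufficiency

section Necessity

theorem sum_weight_nonneg {F : Finset (V × Bool)} (hcard : F.card ≤ k)
    (h : F.Nonempty → ∃ e ∈ F, e.2 = true) : 0 ≤ ∑ e ∈ F, weight k e.2 := by
  rcases F.eq_empty_or_nonempty with rfl | hne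
  · simp
  obtain ⟨e, heF, he⟩ := h hne
  have hweight : ∀ δ, weight k δ + 1 = if δ then (k : ℤ) else 0 := by simp [weight]
  have hle : weight k e.2 + 1 ≤ ∑ e ∈ F, (weight k e.2 + 1) :=
    Finset.single_le_sum (f := fun e : V × Bool => weight k e.2 + 1)
      (fun e _ => by rw [hweight]; split <;> simp) heF
  rw [hweight, if_pos he, Finset.sum_add_distrib, Finset.sum_const, nsmul_one] at hle
  have : (F.card : ℤ) ≤ k := by exact_mod_cast hcard
  linarith

theorem Peels.exists_dominating_mem {L : List (V × Bool)} {U W : Set V} (hp : H.Peels U L W)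
    {E : Finset V} (hE : E ∈ H.edges) (hEU : (E : Set V) ⊆ U) (h : ∃ e ∈ L, e.1 ∈ E) :
    ∃ e ∈ L, e.1 ∈ E ∧ e.2 = true := by
  induction L generalizing U with
  | nil => simp at h
  | cons a L ih =>
    by_cases ha : a.1 ∈ E
    · exact ⟨a, List.mem_cons_self, ha, (removableAs_iff.1 hp.2.1 E (H.card_eq E hE) ha hEU).1 hE⟩
    · obtain ⟨e, he, heE⟩ := h
      have heL := (List.mem_cons.1 he).resolve_left fun hea => ha (hea ▸ heE)
      obtain ⟨e', he', heE'⟩ := ih hp.2.2 (Set.subset_sdiff_singleton hEU ha) ⟨e, heL, heE⟩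
      exact ⟨e', List.mem_cons_of_mem _ he', heE'⟩

theorem IsMatchingOn.totalWeight_nonneg {M : Finset (Finset V)} {U W : Set V}
    {L : List (V × Bool)} (hM : H.IsMatchingOn M U) (hp : H.Peels U L W) :
    0 ≤ totalWeight k L := by
  classical
  have hunion : L.toFinset = M.biUnion fun E => L.toFinset.filter fun e => e.1 ∈ E := by
    ext e
    have hcov : e ∈ L → ∃ E ∈ M, e.1 ∈ E := fun he =>
      (hM.exists_mem_iff e.1).2 (hp.vertexSet_subset (List.mem_map_of_mem he))
    simp only [Finset.mem_biUnion, Finset.mem_filter, List.mem_toFinset]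
    tauto
  have hdisj : (M : Set (Finset V)).PairwiseDisjoint
      fun E => L.toFinset.filter fun e => e.1 ∈ E := fun E hE F hF hne =>
    Finset.disjoint_left.2 fun e he he' => Finset.disjoint_left.1 (hM.pairwiseDisjoint hE hF hne)
      (Finset.mem_filter.1 he).2 (Finset.mem_filter.1 he').2
  rw [totalWeight, ← List.sum_toFinset _ (hp.nodup.of_map _), hunion, Finset.sum_biUnion hdisj]
  refine Finset.sum_nonneg fun E hE => sum_weight_nonneg ?_ fun ⟨e, he⟩ => ?_
  · rw [← H.card_eq E (hM.mem_edges E hE)]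
    refine Finset.card_le_card_of_injOn Prod.fst (fun e he => (Finset.mem_filter.1 he).2) ?_
    exact fun e he e' he' => List.inj_on_of_nodup_map hp.nodup
      (List.mem_toFinset.1 (Finset.mem_filter.1 he).1)
      (List.mem_toFinset.1 (Finset.mem_filter.1 he').1)
  · rw [Finset.mem_filter, List.mem_toFinset] at he
    obtain ⟨e', he', heE', hdom⟩ := hp.exists_dominating_mem (hM.mem_edges E hE)
      (fun x hx => (hM.exists_mem_iff x).1 ⟨E, hE, hx⟩) ⟨e, he⟩
    exact ⟨e', Finset.mem_filter.2 ⟨List.mem_toFinset.2 he', heE'⟩, hdom⟩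

theorem IsMatchingOn.dvd_length {M : Finset (Finset V)} {U : Set V} {L : List (V × Bool)}
    (hM : H.IsMatchingOn M U) (hp : H.Peels U L ∅) : k ∣ L.length := by
  classical
  have hunion : (L.map Prod.fst).toFinset = M.biUnion id := by
    ext x
    rw [List.mem_toFinset, Finset.mem_biUnion]
    exact (Set.ext_iff.1 hp.vertexSet_eq x).trans (hM.exists_mem_iff x).symm
  rw [← List.length_map (f := Prod.fst), ← List.toFinset_card_of_nodup hp.nodup, hunion,
    Finset.card_biUnion fun E hE F hF => hM.pairwiseDisjoint hE hF]
  exact Finset.dvd_sum fun E hE => (H.card_eq E (hM.mem_edges E hE)).symm.dvd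

end Necessity

theorem Peels.hasPerfectMatching_iff {L : List (V × Bool)} (hp : H.Peels Set.univ L ∅) :
    H.HasPerfectMatching ↔ k ∣ L.length ∧ Balanced k 0 L := by
  rw [hasPerfectMatching_iff_exists_isMatchingOn]
  refine ⟨fun ⟨M, hM⟩ => ⟨hM.dvd_length hp, ?_⟩,
    fun ⟨⟨m, hm⟩, hb⟩ => hp.exists_isMatchingOn m hm hb⟩
  rintro P ⟨Q, rfl⟩
  obtain ⟨W, hP, -⟩ := peels_append.1 hp
  rw [zero_add]
  exact hM.totalWeight_nonneg hP

section EliminationOrder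

variable {n : ℕ} {v : Fin n ≃ V}

theorem length_peelingOf (H : KHypergraph k V) (v : Fin n ≃ V) : (H.peelingOf v).length = n := by
  simp [peelingOf]

theorem toFinset_drop_finRange (j : Fin n) :
    ((List.finRange n).drop j).toFinset = Finset.univ.filter (j ≤ ·) := by
  ext i
  simp only [List.mem_toFinset, List.mem_drop_iff_getElem, List.getElem_finRange,
    Finset.mem_filter_univ]
  exact ⟨fun ⟨m, _, hm⟩ => hm ▸ Nat.le_add_right _ _, fun hij => ⟨i - j, by grind, by grind⟩⟩

theorem IsEliminationOrder.totalWeight_take (h : H.IsEliminationOrder v) (j : Fin n) :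
    totalWeight k ((H.peelingOf v).take (n - j)) = H.balance v j := by
  classical
  have hiso : ∀ i, (H.IsolatingAt v i ∧ ¬ H.DominatingAt v i) ↔ ¬ H.DominatingAt v i :=
    fun i => and_iff_right_of_imp (h i).resolve_left
  have htake : (List.finRange n).reverse.take (n - j) = ((List.finRange n).drop j).reverse := by
    rw [List.take_reverse, List.length_finRange, Nat.sub_sub_self j.2.le]
  rw [totalWeight, peelingOf, ← List.map_take, htake, List.map_map, List.map_reverse,
    List.sum_reverse,
    ← List.sum_toFinset _ ((List.nodup_finRange n).sublist (List.drop_sublist _ _)),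
    toFinset_drop_finRange, balance, numDominating, numIsolating]
  simp only [hiso, ← Finset.filter_filter, Function.comp_apply, weight, decide_eq_true_eq]
  rw [Finset.sum_ite, Finset.sum_const, Finset.sum_const, nsmul_eq_mul, nsmul_eq_mul]
  ring

theorem IsEliminationOrder.balanced_iff (h : H.IsEliminationOrder v) :
    Balanced k 0 (H.peelingOf v) ↔ ∀ j : Fin n, 0 ≤ H.balance v j := by
  refine ⟨fun hb j => ?_, fun hbal P hP => ?_⟩
  · simpa only [zero_add, h.totalWeight_take] using hb _ (List.take_prefix (n - j) _)
  · have hlen := hP.length_le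
    rw [length_peelingOf] at hlen
    rcases Nat.eq_zero_or_pos P.length with hP0 | hpos
    · rw [List.eq_nil_of_length_eq_zero hP0]
      simp [totalWeight]
    · have hj := hbal ⟨n - P.length, by omega⟩
      rw [← h.totalWeight_take, Nat.sub_sub_self hlen, ← List.prefix_iff_eq_take.1 hP] at hj
      rwa [zero_add]

theorem IsEliminationOrder.hasPerfectMatching_iff (h : H.IsEliminationOrder v) :
    H.HasPerfectMatching ↔ k ∣ n ∧ ∀ j : Fin n, 0 ≤ H.balance v j := by
  rw [h.peels.hasPerfectMatching_iff, length_peelingOf, h.balanced_iff]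

end EliminationOrder

end Matching

open StackProg StackMemory

/-- The stacks of the machine. The input is read from `tensor`, which then holds the adjacency
tensor and at the end the answer. The stack `alive` holds the characteristic list of the remaining
vertices, `balance` and `fails` hold a `Tally`, `dom` and `iso` the characteristic lists of the
dominating and the isolating vertices, and `size` and `rounds` are counters. -/
inductive Stack : Type
  | tensor | alive | size | rounds | balance | fails | work | out | right | left | temp | iso | dom
  deriving DecidableEq

instance : Fintype Stack where
  elems := {.tensor, .alive, .size, .rounds, .balance, .fails, .work, .out, .right, .left, .temp,
    .iso, .dom}
  complete x := by cases x <;> decide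

/-- The store of the machine: one field for each stack. -/
@[ext]
structure Mem : Type where
  tensor : List Bool := []
  alive : List Bool := []
  size : List Bool := []
  rounds : List Bool := []
  balance : List Bool := []
  fails : List Bool := []
  work : List Bool := []
  out : List Bool := []
  right : List Bool := []
  left : List Bool := []
  temp : List Bool := []
  iso : List Bool := []
  dom : List Bool := []

namespace Mem

/-- The content of a stack. -/
@[simp]
def get (m : Mem) : Stack → List Bool
  | .tensor => m.tensor
  | .alive => m.alive
  | .size => m.size
  | .rounds => m.rounds
  | .balance => m.balance
  | .fails => m.fails
  | .work => m.work
  | .out => m.out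
  | .right => m.right
  | .left => m.left
  | .temp => m.temp
  | .iso => m.iso
  | .dom => m.dom

/-- Replace the content of a stack. -/
@[simp]
def set (a : Stack) (l : List Bool) (m : Mem) : Mem :=
  match a with
  | .tensor => { m with tensor := l }
  | .alive => { m with alive := l }
  | .size => { m with size := l }
  | .rounds => { m with rounds := l }
  | .balance => { m with balance := l }
  | .fails => { m with fails := l }
  | .work => { m with work := l }
  | .out => { m with out := l }
  | .right => { m with right := l }
  | .left => { m with left := l }
  | .temp => { m with temp := l }
  | .iso => { m with iso := l }
  | .dom => { m with dom := l }

instance : StackMemory Stack Mem where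
  get := get
  set := set
  get_set a l m := by
    funext b
    cases a <;> cases b <;> rfl
  get_injective m m' h := by
    ext1
    exacts [congrFun h .tensor, congrFun h .alive, congrFun h .size, congrFun h .rounds,
      congrFun h .balance, congrFun h .fails, congrFun h .work, congrFun h .out, congrFun h .right,
      congrFun h .left, congrFun h .temp, congrFun h .iso, congrFun h .dom]

@[simp]
theorem stackMemory_get (m : Mem) : StackMemory.get m = m.get := rfl

@[simp]
theorem stackMemory_set (a : Stack) (l : List Bool) (m : Mem) :
    StackMemory.set a l m = m.set a l := rfl

theorem get_input (l : List Bool) :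
    StackMemory.get ({ tensor := l } : Mem) = Function.update (fun _ => []) .tensor l := by
  funext a
  cases a <;> rfl

/-- The store in which a program maps blocks of length `n` from `work` to `out`, with the current
block on `right` and the other scratch stacks empty. -/
def load (m : Mem) (n : ℕ) (work : List Bool) (out right : List Bool := []) : Mem :=
  { m with size := List.replicate n true, work, out, right, left := [], temp := [] }

end Mem

section Bits

variable {α β : Type*} {l : List α} {p q : α → Prop}

open Classical in
/-- The characteristic list of a predicate on the members of a list. -/
noncomputable def bits (l : List α) (p : α → Prop) : List Bool := l.map fun x => decide (p x)

theorem bits_cons (x : α) (l : List α) (p : α → Prop) [Decidable (p x)] :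
    bits (x :: l) p = decide (p x) :: bits l p := by
  simp only [bits, List.map_cons]
  congr

theorem bits_append (l l' : List α) (p : α → Prop) :
    bits (l ++ l') p = bits l p ++ bits l' p :=
  List.map_append

theorem bits_reverse (l : List α) (p : α → Prop) : bits l.reverse p = (bits l p).reverse :=
  List.map_reverse

theorem length_bits (l : List α) (p : α → Prop) : (bits l p).length = l.length :=
  List.length_map _

theorem bits_map (f : β → α) (l : List β) (p : α → Prop) :
    bits (l.map f) p = bits l fun y => p (f y) :=
  List.map_map

theorem bits_flatMap (f : β → List α) (l : List β) (p : α → Prop) :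
    bits (l.flatMap f) p = l.flatMap fun y => bits (f y) p :=
  List.map_flatMap

theorem bits_congr (h : ∀ x ∈ l, (p x ↔ q x)) : bits l p = bits l q :=
  List.map_congr_left fun x hx => by rw [h x hx]

theorem map_and_bits {P R : List α} {x : α} (h : (P ++ x :: R).Nodup)
    (p : α → Prop) [Decidable (p x)] :
    (bits P p ++ false :: bits R p).map (· && decide (p x)) =
      bits (P ++ x :: R) fun y => y ≠ x ∧ p y ∧ p x := by
  classical
  have hmask : ∀ l : List α, x ∉ l →
      (bits l p).map (· && decide (p x)) = bits l fun y => y ≠ x ∧ p y ∧ p x := by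
    intro l hx
    rw [bits, bits, List.map_map]
    refine List.map_congr_left fun y hy => ?_
    have hyx : y ≠ x := fun h => hx (h ▸ hy)
    simp [hyx]
  have hx : x ∉ P ∧ x ∉ R := by
    rw [List.nodup_middle, List.nodup_cons, List.mem_append, not_or] at h
    exact h.1
  rw [List.map_append, List.map_cons, hmask P hx.1, hmask R hx.2, bits_append, bits_cons]
  simp

end Bits

section Programs

/-- With a block split as `left.reverse ++ x :: right`, append to `out` a copy of it with the entry
at `x` removed, or a zero block if `x` is `false`. -/
def rowProg (x : Bool) : StackProg Stack :=
  seq (move .left .temp) <| seq (fork .temp .left .out (· && x)) <| seq (push .out false) <|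
    seq (fork .right .temp .out (· && x)) <| seq (move .temp .right) (push .left x)

theorem run_rowProg (m : Mem) (x : Bool) (l r o : List Bool) :
    Run (rowProg x) { m with left := l, right := r, temp := [], out := o }
      (5 * (l.length + r.length) + 6)
      { m with left := x :: l, right := r, temp := [],
               out := ((l.reverse ++ false :: r).map (· && x)).reverse ++ o } := by
  refine ((run_move (by decide) _).seq <| (run_fork (by decide) (by decide) (by decide) _ _).seq <|
    (Run.push _ _ _).seq <| (run_fork (by decide) (by decide) (by decide) _ _).seq <|
    (run_move (by decide) _).seq (Run.push _ _ _)).cast ?_ ?_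
  · simp
  · simp only [Mem.stackMemory_get, Mem.stackMemory_set, Mem.get, Mem.set, List.append_nil,
      List.length_reverse, List.map_reverse, List.reverse_reverse]
    omega

theorem run_loop_rowProg {α : Type*} (m : Mem) (p : α → Prop) {P R : List α} (h : (P ++ R).Nodup)
    (o : List Bool) :
    Run (loop .right rowProg)
      { m with left := (bits P p).reverse, right := bits R p, temp := [], out := o }
      (R.length * (5 * (P.length + R.length) + 7) + 1)
      { m with left := (bits (P ++ R) p).reverse, right := [], temp := [],
               out := (R.flatMap fun x =>
                 bits (P ++ R) fun y => y ≠ x ∧ p y ∧ p x).reverse ++ o } := by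
  classical
  induction R generalizing P o with
  | nil => exact (Run.loop_nil rfl).cast (by simp [bits]) le_add_self
  | cons x R ih =>
    have hrow := (run_rowProg m (decide (p x)) (bits P p).reverse (bits R p) o).cast
      (s'' := { m with left := (bits (P ++ [x]) p).reverse, right := bits R p, temp := [],
                       out := (bits (P ++ x :: R) fun y => y ≠ x ∧ p y ∧ p x).reverse ++ o })
      (by rw [List.reverse_reverse, map_and_bits h, bits_append, List.reverse_append]; simp [bits])
      le_rfl
    rw [List.append_cons] at h
    refine (Run.loop_cons (bits_cons x R p) hrow (ih h _)).cast ?_ ?_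
    · simp
    · simp only [List.length_reverse, length_bits, List.length_append, List.length_cons,
        List.length_nil]
      ring_nf
      omega

/-- Move a block of bits from `work` to `right`; its length is given by the counter `size`. -/
def takeBlock : StackProg Stack :=
  seq (loop .size fun _ => seq (pop .work skip fun x => push .left x) (push .temp true)) <|
    seq (move .temp .size) (move .left .right)

theorem run_takeBlock_loop (m : Mem) (b w l t : List Bool) :
    Run (loop .size fun _ => seq (pop .work skip fun x => push .left x) (push .temp true))
      { m with size := List.replicate b.length true, work := b ++ w, left := l, temp := t }
      (4 * b.length + 1)
      { m with size := [], work := w, left := b.reverse ++ l,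
               temp := List.replicate b.length true ++ t } := by
  induction b generalizing l t with
  | nil => exact Run.loop_nil rfl
  | cons x b ih =>
    refine (Run.loop_cons rfl ((Run.pop_cons rfl (Run.push _ _ _)).seq (Run.push _ _ _))
      (ih (x :: l) (true :: t))).cast ?_ ?_
    · simp [List.replicate_succ']
    · rw [List.length_cons]
      omega

theorem run_takeBlock (m : Mem) (b w o : List Bool) :
    Run takeBlock (m.load b.length (b ++ w) o) (8 * b.length + 3) (m.load b.length w o b) := by
  refine ((run_takeBlock_loop (m.load b.length (b ++ w) o) b w [] []).seq <|
    (run_move (by decide) _).seq (run_move (by decide) _)).cast ?_ ?_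
  · simp [Mem.load]
  · simp only [Mem.stackMemory_get, Mem.stackMemory_set, Mem.get, Mem.set, List.append_nil,
      List.length_reverse, List.length_replicate, List.reverse_replicate]
    omega

/-- Run `p` on each of the blocks of the list on `work`, and collect the outputs. -/
def mapBlocks (p : StackProg Stack) : StackProg Stack :=
  seq (loop .work fun x => seq (push .work x) <| seq takeBlock p) (move .out .work)

section MapBlocks

variable {ι : Type*} {m : Mem} {n T c : ℕ} {p : StackProg Stack} {B C : ι → List Bool}

theorem run_mapBlocks_loop (hn : n ≠ 0) (hB : ∀ i, (B i).length = n)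
    (hp : ∀ i w o, Run p (m.load n w o (B i)) T (m.load n w ((C i).reverse ++ o)))
    (F : List ι) (o : List Bool) :
    Run (loop .work fun x => seq (push .work x) <| seq takeBlock p) (m.load n (F.flatMap B) o)
      (F.length * (8 * n + 5 + T) + 1) (m.load n [] ((F.flatMap C).reverse ++ o)) := by
  induction F generalizing o with
  | nil => exact (Run.loop_nil rfl).mono le_add_self
  | cons i F ih =>
    obtain ⟨x, b, hb⟩ := List.exists_cons_of_length_pos ((hB i).symm ▸ Nat.pos_of_ne_zero hn)
    have hwork : (m.load n ((i :: F).flatMap B) o).work = x :: (b ++ F.flatMap B) := by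
      simp [Mem.load, hb]
    have hpush : Run (push .work x) (m.load n (b ++ F.flatMap B) o) 1
        (m.load n (B i ++ F.flatMap B) o) := by
      rw [hb]
      exact Run.push _ _ _
    have htake := run_takeBlock m (B i) (F.flatMap B) o
    rw [hB i] at htake
    refine (Run.loop_cons hwork (hpush.seq (htake.seq (hp i _ o))) (ih _)).cast ?_ ?_
    · simp
    · rw [List.length_cons]
      ring_nf
      omega

theorem run_mapBlocks (hn : n ≠ 0) (hB : ∀ i, (B i).length = n) (hC : ∀ i, (C i).length = c)
    (hp : ∀ i w o, Run p (m.load n w o (B i)) T (m.load n w ((C i).reverse ++ o)))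
    (F : List ι) :
    Run (mapBlocks p) (m.load n (F.flatMap B)) (F.length * (8 * n + 5 + T + 2 * c) + 2)
      (m.load n (F.flatMap C)) := by
  refine ((run_mapBlocks_loop hn hB hp F []).seq (run_move (by decide) _)).cast ?_ ?_
  · simp [Mem.load]
  · simp only [Mem.load, Mem.stackMemory_get, Mem.get, List.append_nil, List.length_reverse,
      List.length_flatMap, hC, List.map_const', List.sum_replicate, smul_eq_mul]
    ring_nf
    omega

end MapBlocks

/-- Replace each block on `work` by one block for each of its entries: the block with this entry
removed, or a zero block if the entry is `false`. -/
def expandProg : StackProg Stack := mapBlocks (seq (loop .right rowProg) (drop .left))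

/-- Replace each block on `work` by the conjunction of its entries. -/
def reduceProg : StackProg Stack := mapBlocks (seq (count .right .left false) (testNil .left .out))

section Blocks

variable {α : Type*} {L : List α}

theorem run_expandProg (hL : L ≠ []) (hnd : L.Nodup) (m : Mem) (F : List (α → Prop)) :
    Run expandProg (m.load L.length (F.flatMap fun p => bits L p))
      (F.length * (7 * L.length ^ 2 + 17 * L.length + 7) + 2)
      (m.load L.length
        (F.flatMap fun p => L.flatMap fun x => bits L fun y => y ≠ x ∧ p y ∧ p x)) := by
  refine (run_mapBlocks (T := 5 * L.length ^ 2 + 9 * L.length + 2) (c := L.length ^ 2)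
    (by simpa using hL) (length_bits L) (fun p => ?_) (fun p w o => ?_) F).mono ?_
  · simp [length_bits, sq]
  · refine ((run_loop_rowProg (m.load L.length w) p (P := []) hnd o).seq (run_drop _ _)).cast rfl ?_
    simp only [Mem.stackMemory_get, Mem.get, List.nil_append, List.length_nil, List.length_reverse,
      length_bits, zero_add]
    ring_nf
    omega
  · ring_nf
    omega

theorem run_reduceProg (hL : L ≠ []) (m : Mem) (F : List (α → Prop)) :
    Run reduceProg (m.load L.length (F.flatMap fun p => bits L p))
      (F.length * (12 * L.length + 11) + 2)
      (m.load L.length (bits F fun p => ∀ x ∈ L, p x)) := by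
  classical
  have hbits : bits F (fun p => ∀ x ∈ L, p x) = F.flatMap fun p =>
      bits [p] fun p => ∀ x ∈ L, p x := by
    rw [← bits_flatMap, List.flatMap_singleton']
  rw [hbits]
  refine (run_mapBlocks (T := 4 * L.length + 4) (c := 1) (by simpa using hL) (length_bits L)
    (fun p => rfl) (fun p w o => ?_) F).mono (by ring_nf; omega)
  have hcount : (bits L p).count false ≤ L.length := (length_bits L p) ▸ List.count_le_length
  refine ((run_count (by decide) false _).seq (run_testNil (by decide) _)).cast ?_ ?_
  · simp [Mem.load, bits, List.count_eq_zero]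
  · simp only [Mem.load, Mem.stackMemory_get, Mem.stackMemory_set, Mem.get, Mem.set,
      List.append_nil, List.length_replicate, length_bits]
    omega

end Blocks

/-- Replace each bit `x` on `work` by `x → (y = b)`, where `y` is the corresponding bit on
`tensor`. -/
def compareProg (b : Bool) : StackProg Stack :=
  seq (loop .work fun x => pop .tensor skip fun y =>
    seq (push .temp y) (push .out (!x || (y == b)))) <| seq (move .temp .tensor) (move .out .work)

section Compare

variable {α : Type*} (m : Mem) (b : Bool) (p q : α → Prop) (L : List α)

theorem run_compareProg_loop (t o : List Bool) :
    Run (loop .work fun x => pop .tensor skip fun y =>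
        seq (push .temp y) (push .out (!x || (y == b))))
      { m with tensor := bits L q, work := bits L p, temp := t, out := o } (4 * L.length + 1)
      { m with tensor := [], work := [], temp := (bits L q).reverse ++ t,
               out := (bits L fun x => p x → (q x ↔ b = true)).reverse ++ o } := by
  classical
  induction L generalizing t o with
  | nil => exact Run.loop_nil rfl
  | cons x L ih =>
    refine (Run.loop_cons (bits_cons x L p) (Run.pop_cons (bits_cons x L q)
      ((Run.push _ _ _).seq (Run.push _ _ _))) (ih _ _)).cast ?_ ?_
    · have hbit : (!decide (p x) || (decide (q x) == b)) =
          decide (p x → (q x ↔ b = true)) := by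
        by_cases p x <;> by_cases q x <;> cases b <;> simp [*]
      simp only [bits_cons, ← hbit, List.reverse_cons, List.append_assoc, List.singleton_append]
      rfl
    · rw [List.length_cons]
      omega

theorem run_compareProg (n : ℕ) (hm : m.tensor = bits L q) :
    Run (compareProg b) (m.load n (bits L p)) (8 * L.length + 3)
      (m.load n (bits L fun x => p x → (q x ↔ b = true))) := by
  have hstart : m.load n (bits L p) =
      { m.load n [] with tensor := bits L q, work := bits L p, temp := [], out := [] } := by
    rw [← hm]
    rfl
  rw [hstart]
  refine ((run_compareProg_loop (m.load n []) b p q L [] []).seq <|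
    (run_move (by decide) _).seq (run_move (by decide) _)).cast ?_ ?_
  · simp [Mem.load, hm]
  · simp only [Mem.stackMemory_get, Mem.stackMemory_set, Mem.get, Mem.set, List.append_nil,
      List.length_reverse, List.reverse_reverse, length_bits]
    omega

end Compare

end Programs

open Polynomial

section Tuples

variable {n : ℕ}

theorem tuples_succ_snoc (n j : ℕ) : tuples n (j + 1) =
    (tuples n j).flatMap fun t => (List.finRange n).map fun x => t ++ [x] := by
  induction j with
  | zero => simp [tuples, List.map_eq_flatMap]
  | succ j ih =>
    conv_lhs => rw [tuples, ih]
    conv_rhs => rw [tuples]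
    simp only [List.flatMap_assoc, List.map_flatMap, List.flatMap_map, List.map_map,
      Function.comp_def, List.cons_append]

theorem length_tuples (n j : ℕ) : (tuples n j).length = n ^ j := by
  induction j with
  | zero => rfl
  | succ j ih => simp [tuples, ih, List.length_flatMap, pow_succ']

theorem bits_tuples_succ (i : ℕ) (p : List (Fin n) → Prop) : bits (tuples n (i + 1)) p =
    (tuples n i).flatMap fun t => bits (List.finRange n) fun x => p (t ++ [x]) := by
  rw [tuples_succ_snoc, bits_flatMap]
  simp only [bits_map]

theorem bits_tuples_one (p : List (Fin n) → Prop) :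
    bits (tuples n 1) p = bits (List.finRange n) fun x => p [x] :=
  (bits_tuples_succ 0 p).trans (List.flatMap_singleton _ _)

/-- The tuple consists of distinct elements of `U`. -/
def Valid {α : Type*} (U : Set α) (t : List α) : Prop := t.Nodup ∧ ∀ x ∈ t, x ∈ U

theorem valid_snoc_snoc {α : Type*} {U : Set α} {t : List α} {x y : α} :
    Valid U (t ++ [x] ++ [y]) ↔ y ≠ x ∧ Valid U (t ++ [y]) ∧ Valid U (t ++ [x]) := by
  simp only [Valid, List.mem_append, List.mem_singleton]
  grind

theorem forall_length_succ {α : Type*} {i : ℕ} {p : List α → Prop} :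
    (∀ t : List α, t.length = i + 1 → p t) ↔ ∀ x t, t.length = i → p (x :: t) := by
  refine ⟨fun h x t ht => h _ (congrArg (· + 1) ht), fun h t ht => ?_⟩
  obtain ⟨x, t, rfl, hlen⟩ := List.length_eq_succ_iff.1 ht
  exact h x t hlen

theorem removableAs_iff_forall_valid {V : Type*} [DecidableEq V] {j : ℕ}
    {H : KHypergraph (j + 1) V} {U : Set V} {x : V} {δ : Bool} :
    H.RemovableAs U x δ ↔ ∀ t : List V, t.length = j → Valid U (x :: t) →
      ((x :: t).toFinset ∈ H.edges ↔ δ = true) := by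
  rw [removableAs_iff]
  constructor
  · rintro h t rfl ⟨hnd, hU⟩
    refine h _ ?_ ?_ fun y hy => hU y ?_
    · rw [List.toFinset_card_of_nodup hnd, List.length_cons]
    · exact List.mem_toFinset.2 List.mem_cons_self
    · exact List.mem_toFinset.1 hy
  · intro h E hcard hx hU
    have hE : (x :: (E.erase x).toList).toFinset = E := by
      rw [List.toFinset_cons, Finset.toList_toFinset, Finset.insert_erase hx]
    have hmem := h (E.erase x).toList ?_ ⟨?_, fun y hy => hU ?_⟩
    · rwa [hE] at hmem
    · rw [Finset.length_toList, Finset.card_erase_of_mem hx, hcard, Nat.add_sub_cancel]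
    · exact List.nodup_cons.2 ⟨by simp, Finset.nodup_toList _⟩
    · rwa [← List.mem_toFinset, hE] at hy

end Tuples

section Test

variable {n : ℕ} {m : Mem} {N : ℕ}

theorem run_expandProg_tuples (hn : n ≠ 0) (m : Mem) (U : Set (Fin n)) (i : ℕ) :
    Run expandProg (m.load n (bits (tuples n (i + 1)) (Valid U)))
      (n ^ i * (7 * n ^ 2 + 17 * n + 7) + 2) (m.load n (bits (tuples n (i + 2)) (Valid U))) := by
  have hne : List.finRange n ≠ [] := by simpa using hn
  have h := run_expandProg hne (List.nodup_finRange n) m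
    ((tuples n i).map fun t x => Valid U (t ++ [x]))
  rw [List.length_finRange, List.length_map, length_tuples, List.flatMap_map, List.flatMap_map,
    ← bits_tuples_succ] at h
  refine h.cast ?_ le_rfl
  simp only [← valid_snoc_snoc]
  rw [bits_tuples_succ, tuples_succ_snoc, List.flatMap_assoc]
  simp only [List.flatMap_map]

theorem run_reduceProg_tuples (hn : n ≠ 0) (m : Mem) (i : ℕ) (p : List (Fin n) → Prop) :
    Run reduceProg (m.load n (bits (tuples n (i + 1)) p))
      (n ^ i * (12 * n + 11) + 2) (m.load n (bits (tuples n i) fun t => ∀ x, p (t ++ [x]))) := by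
  have hne : List.finRange n ≠ [] := by simpa using hn
  have h := run_reduceProg hne m ((tuples n i).map fun t x => p (t ++ [x]))
  rw [List.length_finRange, List.length_map, length_tuples, List.flatMap_map,
    ← bits_tuples_succ, bits_map] at h
  refine h.cast ?_ le_rfl
  simp only [List.mem_finRange, true_imp_iff]

theorem run_rep_expandProg (hn : n ≠ 0) (m : Mem) (U : Set (Fin n)) (j : ℕ) (hN : n ^ (j + 1) ≤ N) :
    Run (rep j expandProg) (m.load n (bits (tuples n 1) (Valid U)))
      (j * (N * (7 * N ^ 2 + 17 * N + 7) + 2) + 1)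
      (m.load n (bits (tuples n (j + 1)) (Valid U))) := by
  refine Run.rep (s := fun i => m.load n (bits (tuples n (i + 1)) (Valid U))) j fun i hi =>
    (run_expandProg_tuples hn m U i).mono ?_
  have hi : n ^ i ≤ N := (Nat.pow_le_pow_right (Nat.pos_of_ne_zero hn) (by omega)).trans hN
  have hnN : n ≤ N := (Nat.le_self_pow j.succ_ne_zero n).trans hN
  gcongr

theorem run_rep_reduceProg (hn : n ≠ 0) (m : Mem) (p : List (Fin n) → Prop) (j : ℕ)
    (hN : n ^ (j + 1) ≤ N) :
    Run (rep j reduceProg) (m.load n (bits (tuples n (j + 1)) p))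
      (j * (N * (12 * N + 11) + 2) + 1)
      (m.load n (bits (tuples n 1) fun t => ∀ t' : List (Fin n), t'.length = j → p (t ++ t'))) := by
  have h := Run.rep (p := reduceProg) (T := N * (12 * N + 11) + 2) (s := fun i =>
    m.load n (bits (tuples n (j - i + 1)) fun t => ∀ t' : List (Fin n), t'.length = i →
      p (t ++ t'))) j fun i hi => ?_
  · simpa using h
  · obtain ⟨d, rfl⟩ := Nat.exists_eq_add_of_lt hi
    have hd : n ^ (d + 1) ≤ N :=
      (Nat.pow_le_pow_right (Nat.pos_of_ne_zero hn) (by omega)).trans hN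
    have hnN : n ≤ N := (Nat.le_self_pow (Nat.succ_ne_zero _) n).trans hN
    simp only [show i + d + 1 - i = d + 1 by omega, show i + d + 1 - (i + 1) = d by omega]
    refine (run_reduceProg_tuples hn m (d + 1) _).cast ?_ (by gcongr)
    simp only [forall_length_succ, List.append_assoc, List.singleton_append]

/-- Compute on `work`, for every vertex `x` on `alive`, whether `x` is dominating (if `b`) or
isolating (if not) among them; `j` is the edge size minus one. Expanding `j` times produces the bits
that tell which of the `(j + 1)`-tuples are `Valid`, in the order of the adjacency tensor, and
reducing `j` times combines the outcomes for the tuples that start with the same vertex. -/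
def testProg (j : ℕ) (b : Bool) : StackProg Stack :=
  seq (move .alive .temp) <| seq (fork .temp .alive .work id) <| seq (rep j expandProg) <|
    seq (compareProg b) (rep j reduceProg)

/-- A bound on the running time of `testProg`. -/
noncomputable def testTime (j : ℕ) : ℕ[X] :=
  (j : ℕ[X]) * (7 * X ^ 3 + 29 * X ^ 2 + 18 * X + 4) + 13 * X + 7

theorem run_testProg {j : ℕ} (hn : n ≠ 0) (hN : n ^ (j + 1) ≤ N) {H : KHypergraph (j + 1) (Fin n)}
    {U : Set (Fin n)} (halive : m.alive = bits (List.finRange n) (· ∈ U))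
    (htensor : m.tensor = bits (tuples n (j + 1)) (·.toFinset ∈ H.edges)) (b : Bool) :
    Run (testProg j b) (m.load n [])
      ((testTime j).eval N)
      (m.load n (bits (List.finRange n) fun x => H.RemovableAs U x b)) := by
  have hnN : n ≤ N := (Nat.le_self_pow (Nat.succ_ne_zero _) n).trans hN
  have hvalid : bits (tuples n 1) (Valid U) = m.alive := by
    rw [halive, bits_tuples_one]
    simp [Valid]
  have hload : Run (fork .temp .alive .work id)
      { m.load n [] with alive := [], temp := m.alive.reverse } (3 * N + 1)
      (m.load n (bits (tuples n 1) (Valid U))) := by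
    refine (run_fork (by decide) (by decide) (by decide) _ _).cast ?_ ?_
    · simp [Mem.load, hvalid]
    · simpa [halive, length_bits] using hnN
  have hmove : Run (move .alive .temp) (m.load n []) (2 * N + 1)
      { m.load n [] with alive := [], temp := m.alive.reverse } := by
    refine (run_move (by decide) _).cast ?_ ?_
    · simp [Mem.load]
    · simpa [Mem.load, halive, length_bits] using hnN
  refine (hmove.seq <| hload.seq <| (run_rep_expandProg hn m U j hN).seq <|
    (run_compareProg m b _ _ _ n htensor).seq (run_rep_reduceProg hn m _ j hN)).cast ?_ ?_
  · simp only [bits_tuples_one, List.singleton_append, removableAs_iff_forall_valid]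
  · simp only [testTime, length_tuples, eval_add, eval_mul, eval_natCast, eval_ofNat, eval_pow,
      eval_X, Nat.cast_id]
    ring_nf at hN ⊢
    omega

end Test

/-- A bookkeeping of designated vertices, in the order of their removal: `balance` counts the free
slots in edges begun by dominating vertices, and `fails` the isolating vertices that found no
slot. -/
@[ext]
structure Tally : Type where
  balance : ℕ := 0
  fails : ℕ := 0

/-- Record a dominating (`true`) or isolating (`false`) vertex; `j` is the edge size minus one. -/
def Tally.charge (j : ℕ) : Tally → Bool → Tally
  | ⟨q, f⟩, true => ⟨q + j, f⟩
  | ⟨0, f⟩, false => ⟨0, f + 1⟩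
  | ⟨q + 1, f⟩, false => ⟨q, f⟩

/-- Record the designated vertices of a list. -/
def Tally.chargeAll {α : Type*} (j : ℕ) (σ : Tally) (L : List (α × Bool)) : Tally :=
  L.foldl (fun σ e => σ.charge j e.2) σ

/-- The store with the list `l` on `alive` and the counters given by `σ`. -/
def Mem.record (m : Mem) (l : List Bool) (σ : Tally) : Mem :=
  { m with alive := l, balance := List.replicate σ.balance true,
           fails := List.replicate σ.fails true }

section Update

variable {α : Type*}

open Classical in
/-- The members of `L` in `U` that can be removed, where `R x δ` means that `x` can be removed with
the designation `δ`. A vertex that can be removed either way is designated dominating. -/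
noncomputable def removals (U : Set α) (R : α → Bool → Prop) (L : List α) : List (α × Bool) :=
  (L.filter fun x => x ∈ U ∧ (R x true ∨ R x false)).map fun x => (x, decide (R x true))

/-- Record the designation `δ` in the counters. -/
def chargeProg (j : ℕ) (δ : Bool) : StackProg Stack :=
  if δ then rep j (push .balance true) else pop .balance (push .fails true) fun _ => skip

theorem run_chargeProg (m : Mem) (l : List Bool) (j : ℕ) (σ : Tally) (δ : Bool) :
    Run (chargeProg j δ) (m.record l σ) (j + 2) (m.record l (σ.charge j δ)) := by
  obtain ⟨q, f⟩ := σ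
  match δ, q with
  | true, q =>
    have h := Run.rep (T := 1) (s := fun i => m.record l ⟨q + i, f⟩) j fun i _ =>
      Run.push Stack.balance true _
    exact h.cast rfl (by omega)
  | false, 0 => exact (Run.pop_nil rfl (Run.push _ _ _)).cast rfl le_add_self
  | false, q + 1 => exact (Run.pop_cons rfl (Run.skip _)).cast rfl le_add_self

/-- Treat a vertex, given whether it is present, dominating, isolating. -/
def updateVertex (j : ℕ) (x y z : Bool) : StackProg Stack :=
  if x && (y || z) then seq (push .alive false) (chargeProg j y) else push .alive x

open Classical in
theorem run_updateVertex (m : Mem) (l : List Bool) (j : ℕ) (σ : Tally) (U : Set α)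
    (R : α → Bool → Prop) (x : α) :
    Run (updateVertex j (decide (x ∈ U)) (decide (R x true)) (decide (R x false))) (m.record l σ)
      (j + 3)
      (m.record (bits [x] (fun x => x ∈ U ∧ ¬(R x true ∨ R x false)) ++ l)
        (σ.chargeAll j (removals U R [x]))) := by
  by_cases hx : x ∈ U ∧ (R x true ∨ R x false)
  · have hbit : (decide (x ∈ U) && (decide (R x true) || decide (R x false))) = true := by
      simpa using hx
    rw [updateVertex, if_pos hbit]
    have hnot : ¬(x ∈ U ∧ ¬(R x true ∨ R x false)) := fun h => h.2 hx.2
    have hrem : removals U R [x] = [(x, decide (R x true))] := by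
      rw [removals, List.filter_singleton, decide_eq_true hx]
      rfl
    rw [hrem, bits_cons, decide_eq_false hnot]
    exact ((Run.push _ _ _).seq (run_chargeProg m (false :: l) j σ (R x true))).cast rfl (by omega)
  · have hbit : ¬(decide (x ∈ U) && (decide (R x true) || decide (R x false))) = true := by
      simpa using hx
    rw [updateVertex, if_neg hbit]
    have hrem : removals U R [x] = [] := by
      rw [removals, List.filter_singleton, decide_eq_false hx]
      rfl
    have hmem : (x ∈ U ∧ ¬(R x true ∨ R x false)) ↔ x ∈ U :=
      and_iff_left_of_imp fun h => not_and.1 hx h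
    rw [hrem, bits_cons, decide_eq_decide.2 hmem]
    exact (Run.push _ _ _).cast rfl (by omega)

/-- Remove the vertices on `right` that are found dominating or isolating according to the lists on
`dom` and `iso`, record them in the counters, and put the others on `alive`. -/
def updateProg (j : ℕ) : StackProg Stack :=
  loop .right fun x => pop .dom skip fun y => pop .iso skip fun z => updateVertex j x y z

theorem run_updateProg (m : Mem) (j : ℕ) (U : Set α) (R : α → Bool → Prop) (L : List α)
    (l : List Bool) (σ : Tally) :
    Run (updateProg j)
      (Mem.record { m with right := bits L (· ∈ U), dom := bits L (R · true),
                           iso := bits L (R · false) } l σ)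
      (L.length * (j + 6) + 1)
      (Mem.record { m with right := [], dom := [], iso := [] }
        ((bits L fun x => x ∈ U ∧ ¬(R x true ∨ R x false)).reverse ++ l)
        (σ.chargeAll j (removals U R L))) := by
  classical
  induction L generalizing l σ with
  | nil => exact (Run.loop_nil rfl).mono le_add_self
  | cons x L ih =>
    have hvertex := run_updateVertex { m with right := bits L (· ∈ U), dom := bits L (R · true),
                                              iso := bits L (R · false) } l j σ U R x
    refine (Run.loop_cons (bits_cons x L (· ∈ U)) (Run.pop_cons (bits_cons x L (R · true))
      (Run.pop_cons (bits_cons x L (R · false)) hvertex)) (ih _ _)).cast ?_ ?_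
    · have hrem : removals U R (x :: L) = removals U R [x] ++ removals U R L := by
        rw [removals, removals, removals, ← List.map_append, ← List.filter_append,
          List.singleton_append]
      rw [hrem, Tally.chargeAll, Tally.chargeAll, Tally.chargeAll, List.foldl_append]
      simp [bits]
    · rw [List.length_cons]
      ring_nf
      omega

end Update

section Tally

variable {α : Type*} {j : ℕ}

namespace Tally

theorem chargeAll_cons (σ : Tally) (e : α × Bool) (L : List (α × Bool)) :
    σ.chargeAll j (e :: L) = (σ.charge j e.2).chargeAll j L :=
  rfl

theorem chargeAll_append (σ : Tally) (L L' : List (α × Bool)) :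
    σ.chargeAll j (L ++ L') = (σ.chargeAll j L).chargeAll j L' :=
  List.foldl_append

theorem fails_chargeAll_eq_zero {σ : Tally} {L : List (α × Bool)} :
    (σ.chargeAll j L).fails = 0 ↔ σ.fails = 0 ∧ Balanced (j + 1) σ.balance L := by
  induction L generalizing σ with
  | nil => simp [chargeAll, balanced_nil]
  | cons e L ih =>
    rw [chargeAll_cons, ih, balanced_cons]
    obtain ⟨⟨x, δ⟩, q, f⟩ := e, σ
    match δ, q with
    | true, q => simp [charge, weight]
    | false, 0 =>
      have hneg : ¬Balanced (j + 1) (-1) L := fun h => absurd h.nonneg (by decide)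
      simp [charge, weight, hneg]
    | false, q + 1 => simp [charge, weight, add_nonneg]

theorem chargeAll_le (σ : Tally) (L : List (α × Bool)) :
    (σ.chargeAll j L).balance ≤ σ.balance + j * L.length ∧
      (σ.chargeAll j L).fails ≤ σ.fails + L.length := by
  induction L generalizing σ with
  | nil => exact ⟨le_rfl, le_rfl⟩
  | cons e L ih =>
    have hstep : (σ.charge j e.2).balance ≤ σ.balance + j ∧
        (σ.charge j e.2).fails ≤ σ.fails + 1 := by
      obtain ⟨⟨x, δ⟩, q, f⟩ := e, σ
      match δ, q with
      | true, q => exact ⟨le_rfl, Nat.le_succ f⟩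
      | false, 0 => exact ⟨Nat.zero_le _, le_rfl⟩
      | false, q + 1 => exact ⟨by simp only [charge]; omega, Nat.le_succ f⟩
    have htail := ih (σ.charge j e.2)
    rw [chargeAll_cons, List.length_cons, Nat.mul_succ]
    omega

end Tally

theorem mem_vertexSet_removals {U : Set α} {R : α → Bool → Prop} {L : List α} {x : α} :
    x ∈ vertexSet (removals U R L) ↔ x ∈ L ∧ x ∈ U ∧ (R x true ∨ R x false) := by
  simp [vertexSet, removals]

end Tally

section Rounds

/-- The state of the algorithm between two rounds: the set of remaining vertices and the record of
the removed ones. -/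
structure RoundState (n : ℕ) : Type where
  alive : Set (Fin n) := Set.univ
  tally : Tally := {}

variable {j n : ℕ} (H : KHypergraph (j + 1) (Fin n))

/-- The designated vertices that a round removes from `U`. -/
noncomputable def roundRemovals (U : Set (Fin n)) : List (Fin n × Bool) :=
  removals U (H.RemovableAs U) (List.finRange n).reverse

theorem mem_vertexSet_roundRemovals {U : Set (Fin n)} {x : Fin n} :
    x ∈ vertexSet (H.roundRemovals U) ↔
      x ∈ U ∧ (H.RemovableAs U x true ∨ H.RemovableAs U x false) :=
  mem_vertexSet_removals.trans (and_iff_right (List.mem_reverse.2 (List.mem_finRange x)))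

theorem peels_roundRemovals (U : Set (Fin n)) :
    H.Peels U (H.roundRemovals U) (U \ vertexSet (H.roundRemovals U)) := by
  classical
  refine peels_of_forall ?_ fun e he => ?_
  · rw [roundRemovals, removals, List.map_map, Function.comp_def, List.map_id']
    exact (List.nodup_reverse.2 (List.nodup_finRange n)).filter _
  · obtain ⟨x, hx, rfl⟩ := List.mem_map.1 he
    have hx : x ∈ U ∧ (H.RemovableAs U x true ∨ H.RemovableAs U x false) := by
      simpa using hx
    refine ⟨hx.1, ?_⟩
    by_cases hd : H.RemovableAs U x true
    · simpa only [decide_eq_true hd] using hd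
    · simpa only [decide_eq_false hd] using hx.2.resolve_left hd

/-- The state after one more round. -/
noncomputable def nextState (s : RoundState n) : RoundState n where
  alive := s.alive \ vertexSet (H.roundRemovals s.alive)
  tally := s.tally.chargeAll j (H.roundRemovals s.alive)

/-- The state after `i` rounds. -/
noncomputable def stateAfter (i : ℕ) : RoundState n := H.nextState^[i] {}

theorem stateAfter_succ (i : ℕ) : H.stateAfter (i + 1) = H.nextState (H.stateAfter i) :=
  Function.iterate_succ_apply' _ _ _

theorem exists_peels_stateAfter (i : ℕ) : ∃ P, H.Peels Set.univ P (H.stateAfter i).alive ∧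
    (H.stateAfter i).tally = ({} : Tally).chargeAll j P := by
  induction i with
  | zero => exact ⟨[], rfl, rfl⟩
  | succ i ih =>
    obtain ⟨P, hP, htally⟩ := ih
    refine ⟨P ++ H.roundRemovals (H.stateAfter i).alive, ?_, ?_⟩ <;> rw [stateAfter_succ]
    · exact peels_append.2 ⟨_, hP, H.peels_roundRemovals _⟩
    · rw [Tally.chargeAll_append, ← htally, nextState]

theorem tally_stateAfter_le (i : ℕ) :
    (H.stateAfter i).tally.balance ≤ j * n ∧ (H.stateAfter i).tally.fails ≤ n := by
  obtain ⟨P, hP, htally⟩ := H.exists_peels_stateAfter i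
  have hlen : P.length ≤ n := by
    simpa using hP.nodup.length_le_card
  obtain ⟨hbalance, hfails⟩ := ({} : Tally).chargeAll_le (j := j) P
  rw [htally]
  exact ⟨(hbalance.trans_eq (zero_add _)).trans (Nat.mul_le_mul_left j hlen),
    (hfails.trans_eq (zero_add _)).trans hlen⟩

variable {H}

theorem Orderable.ncard_nextState_lt (hH : H.Orderable) {s : RoundState n}
    (hs : s.alive.Nonempty) : (H.nextState s).alive.ncard < s.alive.ncard := by
  obtain ⟨x, hx, δ, hδ⟩ := hH.exists_removableAs hs
  refine Set.ncard_lt_ncard (LE.le.ssubset_of_mem_notMem Set.sdiff_subset hx fun h => h.2 ?_)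
  rw [mem_vertexSet_roundRemovals]
  cases δ
  exacts [⟨hx, .inr hδ⟩, ⟨hx, .inl hδ⟩]

theorem Orderable.ncard_stateAfter_le (hH : H.Orderable) (i : ℕ) :
    (H.stateAfter i).alive.ncard ≤ n - i := by
  induction i with
  | zero => exact (Set.ncard_univ _).trans_le (Nat.card_fin n).le
  | succ i ih =>
    rw [stateAfter_succ]
    rcases (H.stateAfter i).alive.eq_empty_or_nonempty with hs | hs
    · have hempty : (H.nextState (H.stateAfter i)).alive = ∅ := by
        rw [nextState, hs, Set.empty_sdiff]
      rw [hempty, Set.ncard_empty]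
      exact Nat.zero_le _
    · have hlt := hH.ncard_nextState_lt hs
      omega

theorem orderable_iff_stateAfter : H.Orderable ↔ (H.stateAfter n).alive = ∅ := by
  refine ⟨fun hH => ?_, fun h => ?_⟩
  · rw [← Set.ncard_eq_zero, ← Nat.le_zero, ← Nat.sub_self n]
    exact hH.ncard_stateAfter_le n
  · obtain ⟨P, hP, -⟩ := H.exists_peels_stateAfter n
    exact orderable_iff_exists_peels.2 ⟨P, h ▸ hP⟩

theorem Orderable.hasPerfectMatching_iff (hH : H.Orderable) :
    H.HasPerfectMatching ↔ j + 1 ∣ n ∧ (H.stateAfter n).tally.fails = 0 := by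
  obtain ⟨P, hP, htally⟩ := H.exists_peels_stateAfter n
  rw [orderable_iff_stateAfter.1 hH] at hP
  have hlen : P.length = n := by
    have hmem : ∀ x, x ∈ P.map Prod.fst := fun x => hP.vertexSet_eq.ge (Set.mem_univ x)
    simpa using Fintype.card_congr (hP.nodup.getEquivOfForallMemList _ hmem)
  rw [hP.hasPerfectMatching_iff, hlen, htally, Tally.fails_chargeAll_eq_zero]
  simp

end Rounds

section RoundProgram

variable {j n N : ℕ}

/-- Perform a round: remove all vertices that are dominating or isolating among those on `alive`,
and record them on `balance` and `fails`. -/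
def roundProg (j : ℕ) : StackProg Stack :=
  seq (testProg j true) <| seq (move .work .dom) <| seq (testProg j false) <|
    seq (move .work .iso) <| seq (move .alive .right) (updateProg j)

/-- A bound on the running time of `roundProg`. -/
noncomputable def roundTime (j : ℕ) : ℕ[X] := 2 * testTime j + X * (j + 12 : ℕ[X]) + 4

/-- The store between two rounds, with `i` rounds to go. -/
noncomputable def roundMem (H : KHypergraph (j + 1) (Fin n)) (s : RoundState n) (i : ℕ) : Mem :=
  Mem.record
    { tensor := bits (tuples n (j + 1)) (·.toFinset ∈ H.edges)
      size := List.replicate n true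
      rounds := List.replicate i true }
    (bits (List.finRange n) (· ∈ s.alive)) s.tally

theorem run_updateProg_round (H : KHypergraph (j + 1) (Fin n)) (s : RoundState n) (i : ℕ) :
    Run (updateProg j)
      { roundMem H s i with
        alive := []
        right := (bits (List.finRange n) (· ∈ s.alive)).reverse
        dom := (bits (List.finRange n) (H.RemovableAs s.alive · true)).reverse
        iso := (bits (List.finRange n) (H.RemovableAs s.alive · false)).reverse }
      (n * (j + 6) + 1) (roundMem H (H.nextState s) i) := by
  have hupdate := run_updateProg (roundMem H s i) j s.alive (H.RemovableAs s.alive)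
    (List.finRange n).reverse [] s.tally
  simp only [bits_reverse, List.reverse_reverse, List.append_nil, List.length_reverse,
    List.length_finRange] at hupdate
  have halive : bits (List.finRange n) (· ∈ (H.nextState s).alive) = bits (List.finRange n)
      fun x => x ∈ s.alive ∧ ¬(H.RemovableAs s.alive x true ∨ H.RemovableAs s.alive x false) :=
    bits_congr fun x _ => by
      rw [nextState, Set.mem_sdiff, mem_vertexSet_roundRemovals, not_and]
      exact and_congr_right fun hx => forall_prop_of_true hx
  rw [← halive] at hupdate
  exact hupdate

theorem run_roundProg (hn : n ≠ 0) (hN : n ^ (j + 1) ≤ N) (H : KHypergraph (j + 1) (Fin n))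
    (s : RoundState n) (i : ℕ) :
    Run (roundProg j) (roundMem H s i) ((roundTime j).eval N) (roundMem H (H.nextState s) i) := by
  have hnN : n ≤ N := (Nat.le_self_pow (Nat.succ_ne_zero _) n).trans hN
  have hlen (p : Fin n → Prop) : 2 * (bits (List.finRange n) p).length + 1 ≤ 2 * N + 1 := by
    rw [length_bits, List.length_finRange]
    gcongr
  set D := bits (List.finRange n) (H.RemovableAs s.alive · true)
  set I := bits (List.finRange n) (H.RemovableAs s.alive · false)
  have hdom : Run (testProg j true) (roundMem H s i) _ ((roundMem H s i).load n D) :=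
    run_testProg (m := roundMem H s i) hn hN rfl rfl true
  have hmove_dom : Run (move .work .dom) ((roundMem H s i).load n D) (2 * N + 1)
      { roundMem H s i with dom := D.reverse } :=
    (run_move (by decide) _).cast (by simp [Mem.load, roundMem, Mem.record]) (hlen _)
  have hiso : Run (testProg j false) { roundMem H s i with dom := D.reverse } _
      (Mem.load { roundMem H s i with dom := D.reverse } n I) :=
    run_testProg (m := { roundMem H s i with dom := D.reverse }) hn hN rfl rfl false
  have hmove_iso : Run (move .work .iso) (Mem.load { roundMem H s i with dom := D.reverse } n I)
      (2 * N + 1) { roundMem H s i with dom := D.reverse, iso := I.reverse } :=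
    (run_move (by decide) _).cast (by simp [Mem.load, roundMem, Mem.record]) (hlen _)
  have hmove_alive : Run (move .alive .right)
      { roundMem H s i with dom := D.reverse, iso := I.reverse } (2 * N + 1)
      { roundMem H s i with
        alive := []
        right := (bits (List.finRange n) (· ∈ s.alive)).reverse
        dom := D.reverse
        iso := I.reverse } :=
    (run_move (by decide) _).cast (by simp [roundMem, Mem.record]) (hlen _)
  refine (hdom.seq <| hmove_dom.seq <| hiso.seq <| hmove_iso.seq <| hmove_alive.seq <|
    run_updateProg_round H s i).mono ?_
  have hupdate : n * (j + 6) ≤ N * (j + 6) := by gcongr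
  simp only [roundTime, eval_add, eval_mul, eval_natCast, eval_ofNat, eval_X, Nat.cast_id]
  ring_nf at hupdate ⊢
  omega

end RoundProgram

section Preparation

/-- Read the number of vertices and set up the counters, leaving the adjacency tensor on
`tensor`. -/
def initProg : StackProg Stack :=
  seq (loop .tensor fun x => if x then seq (push .alive true) (seq (push .size true)
    (push .rounds true)) else move .tensor .temp) (move .temp .tensor)

theorem run_initProg_loop (n n' : ℕ) (w : List Bool) :
    Run (loop .tensor fun x => if x then seq (push .alive true) (seq (push .size true)
        (push .rounds true)) else move .tensor .temp)
      ({ tensor := List.replicate n true ++ false :: w, alive := List.replicate n' true,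
         size := List.replicate n' true, rounds := List.replicate n' true } : Mem)
      (4 * n + 2 * w.length + 3)
      ({ temp := w.reverse, alive := List.replicate (n' + n) true,
         size := List.replicate (n' + n) true, rounds := List.replicate (n' + n) true } : Mem) := by
  induction n generalizing n' with
  | zero =>
    have hmove : Run (move .tensor .temp)
        ({ tensor := w, alive := List.replicate n' true, size := List.replicate n' true,
           rounds := List.replicate n' true } : Mem) (2 * w.length + 1)
        ({ temp := w.reverse, alive := List.replicate n' true, size := List.replicate n' true,
           rounds := List.replicate n' true } : Mem) :=
      (run_move (by decide) _).cast (by simp) le_rfl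
    exact (Run.loop_cons rfl hmove (Run.loop_nil rfl)).cast rfl (by omega)
  | succ n ih =>
    refine (Run.loop_cons rfl ((Run.push _ _ _).seq ((Run.push _ _ _).seq (Run.push _ _ _)))
      (ih (n' + 1))).cast ?_ (by omega)
    rw [Nat.add_right_comm, Nat.add_assoc]

theorem run_initProg (n : ℕ) (w : List Bool) :
    Run initProg ({ tensor := List.replicate n true ++ false :: w } : Mem)
      (4 * n + 4 * w.length + 4)
      ({ tensor := w, alive := List.replicate n true, size := List.replicate n true,
         rounds := List.replicate n true } : Mem) := by
  refine ((run_initProg_loop n 0 w).seq (run_move (by decide) _)).cast ?_ ?_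
  · simp
  · simp only [Mem.stackMemory_get, Mem.get, List.length_reverse, zero_add]
    omega

/-- Record on `fails` whether the length of `size` is divisible by `j + 1`. -/
def divideProg (j : ℕ) : StackProg Stack :=
  loop .size fun _ => rep j (pop .size (push .fails true) fun _ => skip)

theorem run_divideProg_step (m : Mem) (j n f : ℕ) :
    Run (rep j (pop .size (push .fails true) fun _ => skip))
      { m with size := List.replicate n true, fails := List.replicate f true } (2 * j + 1)
      { m with size := List.replicate (n - j) true,
               fails := List.replicate (f + (j - n)) true } := by
  induction j generalizing n f with
  | zero =>
    rw [Nat.sub_zero, Nat.zero_sub, Nat.add_zero]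
    exact Run.skip _
  | succ j ih =>
    cases n with
    | zero =>
      refine ((Run.pop_nil rfl (Run.push _ _ _)).seq (ih 0 (f + 1))).cast ?_ (by omega)
      rw [Nat.zero_sub, Nat.zero_sub, Nat.sub_zero, Nat.sub_zero, Nat.add_right_comm,
        Nat.add_assoc]
    | succ n =>
      refine ((Run.pop_cons rfl (Run.skip _)).seq (ih n f)).cast ?_ (by omega)
      rw [Nat.add_sub_add_right, Nat.add_sub_add_right]

theorem run_divideProg (m : Mem) (j n f : ℕ) :
    ∃ f', Run (divideProg j)
        { m with size := List.replicate n true, fails := List.replicate f true }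
        (n * (2 * j + 2) + 1) { m with size := [], fails := List.replicate f' true } ∧
      f' ≤ f + j * n ∧ (f' = 0 ↔ j + 1 ∣ n ∧ f = 0) := by
  induction n using Nat.strong_induction_on generalizing f with
  | _ n ih =>
    cases n with
    | zero => exact ⟨f, (Run.loop_nil rfl).cast rfl (by omega), le_self_add, by simp⟩
    | succ n =>
      obtain ⟨f', hrun, hle, hiff⟩ := ih (n - j) (by omega) (f + (j - n))
      have hsub : n - j ≤ n := Nat.sub_le n j
      refine ⟨f', (Run.loop_cons rfl (run_divideProg_step m j n f) hrun).mono ?_, ?_, ?_⟩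
      · have hmul := Nat.mul_le_mul_right (2 * j + 2) hsub
        have hsucc := Nat.add_one_mul n (2 * j + 2)
        omega
      · have hmul := Nat.mul_le_mul_left j hsub
        rw [Nat.mul_succ]
        omega
      · rw [hiff]
        rcases Nat.lt_or_ge n j with hlt | hge
        · have hdvd : ¬j + 1 ∣ n + 1 := Nat.not_dvd_of_pos_of_lt n.succ_pos (by omega)
          simp only [hdvd, false_and, iff_false]
          omega
        · rw [← Nat.dvd_add_self_right (n := n - j), show n - j + (j + 1) = n + 1 by omega,
            Nat.sub_eq_zero_of_le hge, Nat.add_zero f]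

end Preparation

section Decision

variable {j n N : ℕ}

theorem length_encode {k : ℕ} (H : Σ n : ℕ, KHypergraph k (Fin n)) :
    (encode H).length = H.1 + H.1 ^ k + 1 := by
  rw [encode, List.length_append, List.length_cons, List.length_replicate, List.length_map,
    length_tuples, Nat.add_assoc]

theorem le_length_encode {k : ℕ} (H : Σ n : ℕ, KHypergraph k (Fin n)) :
    H.1 ≤ (encode H).length := by
  rw [length_encode]
  omega

theorem pow_le_length_encode {k : ℕ} (H : Σ n : ℕ, KHypergraph k (Fin n)) :
    H.1 ^ k ≤ (encode H).length := by
  rw [length_encode]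
  omega

theorem run_rounds (hn : n ≠ 0) (hN : n ^ (j + 1) ≤ N) (H : KHypergraph (j + 1) (Fin n))
    (s : RoundState n) (i : ℕ) :
    Run (loop .rounds fun _ => roundProg j) (roundMem H s i)
      (i * ((roundTime j).eval N + 1) + 1) (roundMem H (H.nextState^[i] s) 0) := by
  induction i generalizing s with
  | zero => exact (Run.loop_nil rfl).mono le_add_self
  | succ i ih =>
    refine (Run.loop_cons rfl (run_roundProg hn hN H s i) (ih _)).mono ?_
    rw [Nat.succ_mul]
    omega

/-- Remove vertices in as many rounds as there are vertices; `j` is the edge size minus one. -/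
def removalProg (j : ℕ) : StackProg Stack := seq initProg (loop .rounds fun _ => roundProg j)

/-- A bound on the running time of `removalProg`. -/
noncomputable def removalTime (j : ℕ) : ℕ[X] := X * (roundTime j + 1) + 8 * X + 5

theorem run_removalProg (hn : n ≤ N) (hN : n ^ (j + 1) ≤ N) (H : KHypergraph (j + 1) (Fin n)) :
    Run (removalProg j) ({ tensor := encode ⟨n, H⟩ } : Mem) ((removalTime j).eval N)
      (roundMem H (H.stateAfter n) 0) := by
  have hinit : Run initProg ({ tensor := encode ⟨n, H⟩ } : Mem) (8 * N + 4) (roundMem H {} n) := by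
    refine (run_initProg n (bits (tuples n (j + 1)) (·.toFinset ∈ H.edges))).cast ?_ ?_
    · simp [roundMem, Mem.record, bits]
    · rw [length_bits, length_tuples]
      omega
  have hrounds : Run (loop .rounds fun _ => roundProg j) (roundMem H {} n)
      (n * ((roundTime j).eval N + 1) + 1) (roundMem H (H.stateAfter n) 0) := by
    rcases eq_or_ne n 0 with rfl | hpos
    · exact (Run.loop_nil rfl).mono le_add_self
    · exact run_rounds hpos hN H {} n
  refine (hinit.seq hrounds).mono ?_
  have hmul : n * ((roundTime j).eval N + 1) ≤ N * ((roundTime j).eval N + 1) := by gcongr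
  simp only [removalTime, eval_add, eval_mul, eval_ofNat, eval_one, eval_X]
  omega

/-- Decide orderability, for edge size `j + 1`. -/
def orderableProg (j : ℕ) : StackProg Stack :=
  seq (removalProg j) <| seq (drop .tensor) <| seq (drop .size) <| seq (drop .balance) <|
    seq (drop .fails) <| seq (count .alive .fails true) (testNil .fails .tensor)

/-- Decide whether an orderable hypergraph has a perfect matching, for edge size `j + 1`. -/
def matchingProg (j : ℕ) : StackProg Stack :=
  seq (removalProg j) <| seq (drop .tensor) <| seq (drop .alive) <| seq (drop .balance) <|
    seq (divideProg j) (testNil .fails .tensor)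

/-- A bound on the running times of `orderableProg` and `matchingProg`. -/
noncomputable def decisionTime (j : ℕ) : ℕ[X] := removalTime j + (6 * j + 10 : ℕ[X]) * X + 8

theorem eval_decisionTime (j N : ℕ) :
    (decisionTime j).eval N = (removalTime j).eval N + 6 * (j * N) + 10 * N + 8 := by
  simp only [decisionTime, eval_add, eval_mul, eval_natCast, eval_ofNat, eval_X, Nat.cast_id]
  ring

theorem count_bits_alive_eq_zero (H : KHypergraph (j + 1) (Fin n)) :
    (bits (List.finRange n) (· ∈ (H.stateAfter n).alive)).count true = 0 ↔ H.Orderable := by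
  rw [orderable_iff_stateAfter, List.count_eq_zero, Set.eq_empty_iff_forall_notMem]
  simp [bits]

open Classical in
theorem run_orderableProg (hn : n ≤ N) (hN : n ^ (j + 1) ≤ N) (H : KHypergraph (j + 1) (Fin n)) :
    Run (orderableProg j) ({ tensor := encode ⟨n, H⟩ } : Mem) ((decisionTime j).eval N)
      ({ tensor := [decide H.Orderable] } : Mem) := by
  set l := bits (List.finRange n) (· ∈ (H.stateAfter n).alive)
  have hl : l.length = n := (length_bits _ _).trans List.length_finRange
  have hcount : l.count true ≤ n := hl ▸ List.count_le_length
  obtain ⟨hbalance, hfails⟩ := H.tally_stateAfter_le n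
  have hmul : j * n ≤ j * N := Nat.mul_le_mul_left j hn
  have hanswer : Run (testNil .fails .tensor)
      ({ fails := List.replicate (l.count true) true } : Mem) (2 * n + 3)
      ({ tensor := [decide H.Orderable] } : Mem) := by
    refine (run_testNil (by decide) _).cast ?_ ?_
    · simp [← count_bits_alive_eq_zero, l]
    · simpa using hcount
  have hcollect : Run (count .alive .fails true) ({ alive := l } : Mem) (2 * n + 1)
      ({ fails := List.replicate (l.count true) true } : Mem) :=
    (run_count (by decide) true _).cast (by simp) (by simp [hl])
  refine ((run_removalProg hn hN H).seq <| (run_drop .tensor _).seq <| (run_drop .size _).seq <|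
    (run_drop .balance _).seq <| (run_drop .fails _).seq <| hcollect.seq hanswer).mono ?_
  simp only [Mem.stackMemory_get, Mem.stackMemory_set, Mem.get, Mem.set, roundMem, Mem.record,
    length_bits, length_tuples, List.length_replicate, eval_decisionTime]
  omega

open Classical in
theorem run_matchingProg (hn : n ≤ N) (hN : n ^ (j + 1) ≤ N) {H : KHypergraph (j + 1) (Fin n)}
    (hH : H.Orderable) :
    Run (matchingProg j) ({ tensor := encode ⟨n, H⟩ } : Mem) ((decisionTime j).eval N)
      ({ tensor := [decide H.HasPerfectMatching] } : Mem) := by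
  obtain ⟨hbalance, hfails⟩ := H.tally_stateAfter_le n
  have hmul : j * n ≤ j * N := Nat.mul_le_mul_left j hn
  obtain ⟨f, hdivide, hf, hf_iff⟩ := run_divideProg {} j n (H.stateAfter n).tally.fails
  rw [← hH.hasPerfectMatching_iff] at hf_iff
  have hanswer : Run (testNil .fails .tensor) ({ fails := List.replicate f true } : Mem)
      (2 * f + 3) ({ tensor := [decide H.HasPerfectMatching] } : Mem) :=
    (run_testNil (by decide) _).cast (by simp [← hf_iff]) (by simp)
  refine ((run_removalProg hn hN H).seq <| (run_drop .tensor _).seq <| (run_drop .alive _).seq <|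
    (run_drop .balance _).seq <| hdivide.seq hanswer).mono ?_
  have hloop : n * (2 * j + 2) = 2 * (j * n) + 2 * n := by ring
  simp only [Mem.stackMemory_get, Mem.stackMemory_set, Mem.get, Mem.set, roundMem, Mem.record,
    length_bits, length_tuples, List.length_finRange, List.length_replicate, eval_decisionTime]
  omega

theorem orderable_of_zero {V : Type*} [Finite V] (H : KHypergraph 0 V) : H.Orderable := by
  refine ⟨_, (Finite.equivFin V).symm, fun i => Or.inl fun E hE hx _ => ?_⟩
  rw [Finset.card_eq_zero.1 hE] at hx
  exact absurd hx (Finset.notMem_empty _)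

theorem hasPerfectMatching_iff_of_zero {V : Type*} (H : KHypergraph 0 V) :
    H.HasPerfectMatching ↔ IsEmpty V := by
  refine ⟨fun ⟨M, hM, _, hcover⟩ => ⟨fun x => ?_⟩, fun _ => ⟨∅, by simp, by simp, isEmptyElim⟩⟩
  obtain ⟨E, hE, hx⟩ := hcover x
  rw [Finset.card_eq_zero.1 (H.card_eq E (hM E hE))] at hx
  exact Finset.notMem_empty _ hx

theorem decidableInPolyTime_orderable (k : ℕ) : DecidableInPolyTime encode
    (fun H : (Σ n : ℕ, KHypergraph k (Fin n)) => H.2.Orderable) := by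
  cases k with
  | zero =>
    refine decidableInPolyTime (S := Mem) (seq (drop .tensor) (push .tensor true)) .tensor
      (2 * .X + 2) fun H => ⟨_, _, Mem.get_input _, Mem.get_input _,
        ((run_drop _ _).seq (Run.push _ _ _)).cast ?_ ?_⟩
    · simp [orderable_of_zero]
    · simp
  | succ j =>
    exact decidableInPolyTime (S := Mem) (orderableProg j) .tensor (decisionTime j) fun H =>
      ⟨_, _, Mem.get_input _, Mem.get_input _,
        run_orderableProg (le_length_encode H) (pow_le_length_encode H) H.2⟩

theorem decidableInPolyTime_hasPerfectMatching (k : ℕ) : DecidableInPolyTime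
    (fun H : {H : Σ n : ℕ, KHypergraph k (Fin n) // H.2.Orderable} => encode H.1)
    (fun H => H.1.2.HasPerfectMatching) := by
  cases k with
  | zero =>
    -- The input starts with `1` if there is a vertex, and with `0` otherwise.
    refine decidableInPolyTime (S := Mem)
      (pop .tensor skip fun b => seq (drop .tensor) (push .tensor (!b))) .tensor (2 * .X + 3)
      fun H => ⟨{ tensor := encode H.1 }, _, Mem.get_input _, Mem.get_input _, ?_⟩
    obtain ⟨⟨n, H⟩, hH⟩ := H
    obtain ⟨b, l, hl, hb⟩ : ∃ b l, encode ⟨n, H⟩ = b :: l ∧ (b = false ↔ IsEmpty (Fin n)) := by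
      cases n with
      | zero => exact ⟨_, _, rfl, iff_of_true rfl Fin.isEmpty⟩
      | succ n => exact ⟨_, _, rfl, by simp⟩
    rw [hl]
    refine (Run.pop_cons rfl ((run_drop _ _).seq (Run.push _ _ _))).cast ?_ ?_
    · cases b <;> simp [hasPerfectMatching_iff_of_zero, ← hb]
    · simp only [Mem.stackMemory_get, Mem.stackMemory_set, Mem.get, Mem.set, List.length_cons,
        eval_add, eval_mul, eval_ofNat, eval_X]
      omega
  | succ j =>
    exact decidableInPolyTime (S := Mem) (matchingProg j) .tensor (decisionTime j) fun H =>
      ⟨_, _, Mem.get_input _, Mem.get_input _,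
        run_matchingProg (le_length_encode H.1) (pow_le_length_encode H.1) H.2⟩

end Decision

end KHypergraph

theorem theorem1 (k : ℕ) :
    -- orderability is decidable in polynomial time
    DecidableInPolyTime KHypergraph.encode
      (fun H : (Σ n : ℕ, KHypergraph k (Fin n)) => H.2.Orderable) ∧
    -- perfect matching in orderable hypergraphs is decidable in polynomial time
    DecidableInPolyTime
      (fun H : {H : Σ n : ℕ, KHypergraph k (Fin n) // H.2.Orderable} => KHypergraph.encode H.1)
      (fun H => H.1.2.HasPerfectMatching) ∧
    -- orderability is decided by recursively removing a dominating or isolating vertex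
    (∀ (V : Type*) [Finite V] (H : KHypergraph k V),
      (Nat.card V ≤ k → H.Orderable) ∧
      (k < Nat.card V → (H.Orderable ↔
        ∃ x : V, (H.DominatingIn Set.univ x ∨ H.IsolatingIn Set.univ x) ∧
          (H.delete x).Orderable)) ∧
      ∀ x : V, H.DominatingIn Set.univ x ∨ H.IsolatingIn Set.univ x →
        (H.Orderable ↔ (H.delete x).Orderable)) ∧
    -- the criterion for a perfect matching, for every elimination order
    (∀ (V : Type*) (H : KHypergraph k V) (n : ℕ) (v : Fin n ≃ V),
      H.IsEliminationOrder v →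
        (H.HasPerfectMatching ↔ k ∣ n ∧ ∀ j : Fin n, 0 ≤ H.balance v j)) := by
  refine ⟨KHypergraph.decidableInPolyTime_orderable k,
    KHypergraph.decidableInPolyTime_hasPerfectMatching k, fun V _ H => ?_,
    fun V H n v hv => hv.hasPerfectMatching_iff⟩
  refine ⟨KHypergraph.orderable_of_card_le, fun h => ?_,
    fun x hx => KHypergraph.orderable_iff_delete hx⟩
  have : Nonempty V := (Nat.card_pos_iff.1 (Nat.zero_lt_of_lt h)).1
  exact KHypergraph.orderable_iff_exists_delete
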